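/- **Setting.** Units $i=1,2,\dots$ are followed over periods $t=1,\dots,\mathcal T$ ($\mathcal T$ fixed), with binary treatment $D_{it}$. Treatment is absorbing ($D_{i,t-1}=1\Rightarrow D_{it}=1$) and nobody is treated in period $1$. The group $G_i\in\{2,\dots,\mathcal T,\infty\}$ is the first treated period ($\infty$ if never treated), $p_g=P(G=g)$, and $\mathcal G=\{g: p_g>0\}$. $Y_{it}(g)$ are potential outcomes, $Y_{it}(0):=Y_{it}(\infty)$ is the untreated one, and $Y_{it}=Y_{it}(G_i)$ is observed. Assume: 1. (No anticipation) $Y_{it}=Y_{it}(0)$ for $t<G_i$. 2. (Sampling) the observed data $(Y_{i1},\dots,Y_{i\mathcal T},G_i)$ are iid across $i$. 3. (Interactive fixed effects) $Y_{it}(0)=\theta_t+\eta_i+\lambda_i'F_t+e_{it}$ with fixed $\theta_t\in\mathbb R$, $F_t\in\mathbb R^R$ and random $\eta_i\in\mathbb R$, $\lambda_i\in\mathbb R^R$; $Y_t(0)$ and $e_t$ are integrable and $\mathbb E[e_t\mid\eta,\lambda]=0$. 4. (Unconfoundedness) $\mathbb E[Y_t(0)\mid\eta,\lambda,G]=\mathbb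 E[Y_t(0)\mid\eta,\lambda]$ a.s. for all $t$. Expectations without a unit index are those of a representative unit. Let $\mathcal G^{comp}(g,t)=\{g'\in\mathcal G:t<g'\}$, let $t^{max}(g)$ be the largest $t\le\mathcal T$ with $|\mathcal G^{comp}(g,t)|\ge R+1$, $\mathcal G^\dagger=\{g\in\mathcal G: R+2\le g\le t^{max}(g)\}$, and $\mathcal I=\{(g,t): g\in\mathcal G^\dagger,\ g\le t\le t^{max}(g)\}$. Write $\Delta x_t=x_t-x_{t-1}$; let $\Delta x^{pre(g)}$ be the vector of $\Delta x_s$, $2\le s\le g-1$, and let $\mathbf{\Delta F}^{pre(g)}$ be the $(g-2)\times R$ matrix with rows $\Delta F_s'$. Let $\ell_i^{comp}(g,t)=\big(\mathbf 1\{G_i=g'\}/p_{g'}\big)_{g'\in\mathcal G^{comp}(g,t)}$ and $\mathbf\Lambda^{comp}(g,t)=\mathbb E[\ell^{comp}(g,t)(1,\lambda')]$. Assume also, for all $(g,t)\in\mathcal I$: 5. $\operatorname{Rank}(\mathbf{\Delta F}^{pre(g)})=R$ and $\operatorname{Rank}(\mathbf\Lambda^{comp}(g,t))=R+1$; and $\mathbf\Omega=\mathbf\Omega_g$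 is a known $(g-2)\times R$ matrix of rank $R$ with $\operatorname{Rank}(\mathbf\Omega'\mathbf{\Delta F}^{pre(g)})=\operatorname{Rank}(\mathbf{\Delta F}^{pre(g)})$. 6. $\mathbb E\|(Y_1,\dots,Y_{\mathcal T})\|^4<\infty$, $\widehat{\mathbf W}(g,t)\to_p\mathbf W(g,t)$, and $\mathbf W(g,t)$ is positive definite. **Parameters and estimators.** $ATT(g,t)=\mathbb E[Y_t(g)-Y_t(0)\mid G=g]$. Put $Z_i(g)=(1,(\mathbf\Omega'\Delta Y_i^{pre(g)})')'$, $A_i(g)=\mathbf 1\{G_i=g\}Z_i(g)$, $\mathbf\Gamma(g,t)=\mathbb E[\ell^{comp}(g,t)Z(g)']$, $\mathbf H=(\mathbf\Omega'\mathbf{\Delta F}^{pre(g)})^{-1}\mathbf\Omega'$, $\mathbf B(g,t)=(\mathbf\Gamma'\mathbf W\mathbf\Gamma)^{-1}\mathbf\Gamma'\mathbf W$ and $$\theta^*(g,t)=(\theta_t-\theta_{g-1})-(F_t-F_{g-1})'\mathbf H\,\Delta\theta^{pre(g)},\qquad F^*(g,t)'=(F_t-F_{g-1})'(\mathbf\Omega'\mathbf{\Delta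 F}^{pre(g)})^{-1},$$ $$v_i(g,t)=(e_{it}-e_{i,g-1})-(F_t-F_{g-1})'\mathbf H\,\Delta e_i^{pre(g)},\qquad \delta^*(g,t)=(\theta^*(g,t),F^*(g,t)')'.$$ With $\mathbb E_n$ the sample mean over $i\le n$, $\hat p_g=\mathbb E_n[\mathbf 1\{G_i=g\}]$ and $\widehat{\mathbf\Gamma}=\mathbb E_n[\ell_i^{comp}(g,t)Z_i(g)']$, the estimators are $$\widehat\delta^*(g,t)=(\widehat{\mathbf\Gamma}'\widehat{\mathbf W}\widehat{\mathbf\Gamma})^{-1}\widehat{\mathbf\Gamma}'\widehat{\mathbf W}\,\mathbb E_n[\ell_i^{comp}(g,t)(Y_{it}-Y_{i,g-1})],$$ $$\widehat{ATT}(g,t)=\hat p_g^{-1}\big\{\mathbb E_n[\mathbf 1\{G_i=g\}(Y_{it}-Y_{i,g-1})]-\mathbb E_n[A_i(g)]'\widehat\delta^*(g,t)\big\}.$$ Define $\psi_{igt}=\psi^{(1)}_{igt}+\psi^{(2)}_{igt}+\psi^{(3)}_{igt}+\psi^{(4)}_{igt}$ with $$\psi^{(1)}_{igt}=p_g^{-1}\big(\mathbf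 1\{G_i=g\}(Y_{it}-Y_{i,g-1})-\mathbb E[\mathbf 1\{G=g\}(Y_t-Y_{g-1})]\big),\qquad \psi^{(2)}_{igt}=-p_g^{-1}\mathbb E[A(g)]'\mathbf B(g,t)\ell_i^{comp}(g,t)v_i(g,t),$$ $$\psi^{(3)}_{igt}=-p_g^{-1}\delta^*(g,t)'(A_i(g)-\mathbb E[A(g)]),\qquad \psi^{(4)}_{igt}=-p_g^{-1}ATT(g,t)(\mathbf 1\{G_i=g\}-p_g).$$ Stack over $(g,t)\in\mathcal I$ to obtain the vectors $ATT$, $\widehat{ATT}$ and $\Psi_i=(\psi_{igt})_{(g,t)\in\mathcal I}$. **Proposition.** Under these assumptions $\mathbb E[\Psi]=0$, $\mathbb E\|\Psi\|^2<\infty$, and, as $n\to\infty$, $$\sqrt n(\widehat{ATT}-ATT)=\frac1{\sqrt n}\sum_{i=1}^n\Psi_i+o_p(1)\ \xrightarrow{d}\ \mathcal N(0,\mathbb E[\Psi\Psi']).$$ Moreover, let $w$ be any fixed weight vector indexed by $\mathcal I$, with estimators $\hat w$ satisfying $\sqrt n(\hat w-w)=\frac1{\sqrt n}\sum_{i=1}^n\mathcal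 W_i+o_p(1)$, where the $\mathcal W_i$, jointly with the observed data of unit $i$, are iid across $i$, $\mathbb E[\mathcal W_i]=0$ and $\mathbb E\|\mathcal W_i\|^2<\infty$. Then $$\sqrt n(\hat w'\widehat{ATT}-w'ATT)=\frac1{\sqrt n}\sum_{i=1}^n\big(w'\Psi_i+ATT'\mathcal W_i\big)+o_p(1)\ \xrightarrow{d}\ \mathcal N(0,\sigma_w^2),\qquad \sigma_w^2=\mathbb E\big[(w'\Psi_i+ATT'\mathcal W_i)^2\big].$$ -/

import Mathlib

open MeasureTheory ProbabilityTheory Filter Topology Matrix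

noncomputable section

/-- The primitives of a panel with `T` periods, infinitely many units `i = 0, 1, 2, …`, a binary
treatment, and an interactive fixed effects model with `R` factors.  Periods are the natural
numbers `1, …, T` (values at other times are never used).  Groups are elements of `ℕ∞`: the group
`g` is the period of first treatment, `⊤` means never treated.  The fields are only the raw
variables and parameters; all conditions on them are stated separately below. -/
structure PanelModel (Ω : Type*) (T R : ℕ) where
  /-- `D i t` : is unit `i` treated in period `t`? -/
  D : ℕ → ℕ → Ω → Bool
  /-- `Ypot i t g` : potential outcome of unit `i` in period `t` if it were in group `g`. -/
  Ypot : ℕ → ℕ → ℕ∞ → Ω → ℝ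
  /-- time effects -/
  θ : ℕ → ℝ
  /-- factors -/
  F : ℕ → Fin R → ℝ
  /-- unit effects -/
  η : ℕ → Ω → ℝ
  /-- factor loadings -/
  lam : ℕ → Ω → Fin R → ℝ
  /-- idiosyncratic errors -/
  e : ℕ → ℕ → Ω → ℝ

namespace PanelModel

variable {Ω : Type*} [MeasurableSpace Ω] {T R : ℕ} (M : PanelModel Ω T R) (μ : Measure Ω)

/-! ### Observed data -/

/-- The group `G_i`: first treated period, `⊤` if there is none. -/
def group (i : ℕ) (ω : Ω) : ℕ∞ :=
  sInf ((fun t : ℕ => (t : ℕ∞)) '' {t : ℕ | t ∈ Finset.Icc 1 T ∧ M.D i t ω = true})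

/-- Observed outcome `Y_it = Y_it(G_i)`. -/
def Y (i t : ℕ) (ω : Ω) : ℝ := M.Ypot i t (M.group i ω) ω

/-- Untreated potential outcome `Y_it(0)`: the outcome of a unit that never participates. -/
def Y0 (i t : ℕ) (ω : Ω) : ℝ := M.Ypot i t ⊤ ω

/-- The observed data `(Y_i1, …, Y_iT, G_i)` of unit `i`. -/
def obs (i : ℕ) (ω : Ω) : (Finset.Icc 1 T → ℝ) × ℕ∞ := (fun t => M.Y i t ω, M.group i ω)

/-! ### Assumptions on the model

Population expectations without a unit index are those of the representative unit `0`. -/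

/-- Staggered adoption: treatment is absorbing. -/
def StaggeredAdoption : Prop :=
  ∀ i, ∀ᵐ ω ∂μ, ∀ t ∈ Finset.Icc 2 T, M.D i (t - 1) ω = true → M.D i t ω = true

/-- Units that are already treated in the first period have been dropped. -/
def NoTreatmentInFirstPeriod : Prop := ∀ i, ∀ᵐ ω ∂μ, M.D i 1 ω = false

/-- No anticipation: `Y_it = Y_it(0)` for every period `t < G_i`. -/
def NoAnticipation : Prop :=
  ∀ i, ∀ᵐ ω ∂μ, ∀ t ∈ Finset.Icc 1 T, (t : ℕ∞) < M.group i ω → M.Y i t ω = M.Y0 i t ω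

/-- The observed data are iid across units. -/
def IIDSampling : Prop :=
  iIndepFun (fun i => M.obs i) μ ∧ ∀ i, IdentDistrib (M.obs i) (M.obs 0) μ μ

/-- The interactive fixed effects equation `Y_it(0) = θ_t + η_i + λ_i' F_t + e_it`. -/
def InteractiveFixedEffects : Prop :=
  ∀ i, ∀ᵐ ω ∂μ, ∀ t ∈ Finset.Icc 1 T,
    M.Y0 i t ω = M.θ t + M.η i ω + M.lam i ω ⬝ᵥ M.F t + M.e i t ω

/-- The σ-algebra generated by `(η, λ)`. -/
abbrev sigmaHet : MeasurableSpace Ω :=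
  MeasurableSpace.comap (fun ω => (M.η 0 ω, M.lam 0 ω)) inferInstance

/-- The σ-algebra generated by `(η, λ, G)`. -/
abbrev sigmaHetGroup : MeasurableSpace Ω :=
  MeasurableSpace.comap (fun ω => (M.η 0 ω, M.lam 0 ω, M.group 0 ω)) inferInstance

/-- What is needed for the conditional expectations given `(η, λ)` and `(η, λ, G)` to make sense:
measurable conditioning variables, integrable untreated outcomes and errors. -/
structure Regular : Prop where
  measurable_eta : Measurable (M.η 0)
  measurable_lam : Measurable (M.lam 0)
  measurable_group : Measurable (M.group 0)
  integrable_Y0 : ∀ t ∈ Finset.Icc 1 T, Integrable (M.Y0 0 t) μ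
  integrable_e : ∀ t ∈ Finset.Icc 1 T, Integrable (M.e 0 t) μ

/-- The errors of the interactive fixed effects model have mean zero given the unobserved
heterogeneity: `E[e_t | η, λ] = 0`. -/
def ErrorsMeanZero : Prop :=
  ∀ t ∈ Finset.Icc 1 T, μ[M.e 0 t | M.sigmaHet] =ᵐ[μ] 0

/-- Unconfoundedness given unobserved heterogeneity:
`E[Y_t(0) | η, λ, G] = E[Y_t(0) | η, λ]` a.s. -/
def Unconfounded : Prop :=
  ∀ t ∈ Finset.Icc 1 T, μ[M.Y0 0 t | M.sigmaHetGroup] =ᵐ[μ] μ[M.Y0 0 t | M.sigmaHet]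

/-- `E‖(Y_1, …, Y_T)‖⁴ < ∞` for the Euclidean norm. -/
def FourthMoment : Prop :=
  Integrable (fun ω => (∑ t ∈ Finset.Icc 1 T, (M.Y 0 t ω) ^ 2) ^ 2) μ

/-! ### Groups, comparison groups and the identified pairs -/

/-- `p_g = P(G = g)`. -/
def p (g : ℕ∞) : ℝ := μ.real {ω | M.group 0 ω = g}

/-- The set of groups `𝒢`: all `g ∈ {2, …, T, ∞}` that occur with positive probability. -/
def groups : Finset ℕ∞ :=
  (insert ⊤ ((Finset.Icc 2 T).image fun t : ℕ => (t : ℕ∞))).filter fun g => 0 < M.p μ g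

/-- `𝒢^comp(g,t) = {g' ∈ 𝒢 : t < g'}`, which does not depend on `g`. -/
def comp (t : ℕ) : Finset ℕ∞ := (M.groups μ).filter fun g' => (t : ℕ∞) < g'

/-- `t^max(g)`, the largest period `t` with `|𝒢^comp(g,t)| ≥ R + 1`; it does not depend on `g`.
(It is `0` if there is no such period, and then no group is identified.) -/
def tmax : ℕ := ((Finset.Icc 1 T).filter fun t => R + 1 ≤ (M.comp μ t).card).sup id

/-- `𝒢† = {g ∈ 𝒢 : R + 2 ≤ g ≤ t^max(g)}`. -/
def groupsDagger : Finset ℕ :=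
  (Finset.Icc (R + 2) (M.tmax μ)).filter fun g : ℕ => (g : ℕ∞) ∈ M.groups μ

/-- The pairs `(g,t)` with `g ∈ 𝒢†` and `t ∈ {g, …, t^max(g)}`. -/
def identified : Finset (ℕ × ℕ) :=
  (M.groupsDagger μ ×ˢ Finset.Icc 1 (M.tmax μ)).filter fun k => k.1 ≤ k.2

/-- `ATT(g,t) = E[Y_t(g) - Y_t(0) | G = g]`. -/
def ATT (g t : ℕ) : ℝ :=
  ∫ ω, (M.Ypot 0 t (g : ℕ∞) ω - M.Y0 0 t ω) ∂(μ[|{ω | M.group 0 ω = (g : ℕ∞)}])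

/-! ### Pre-treatment differences and the transformed parameters

The pre-treatment periods `2, …, g - 1` index vectors of length `g - 2`. -/

/-- `ΔF^pre(g)`, with rows `ΔF_s'` for `s = 2, …, g - 1`. -/
def dFpre (g : ℕ) : Matrix (Finset.Ico 2 g) (Fin R) ℝ :=
  Matrix.of fun s r => M.F s r - M.F (s - 1) r

/-- `Δθ^pre(g)`. -/
def dThetaPre (g : ℕ) : Finset.Ico 2 g → ℝ := fun s => M.θ s - M.θ (s - 1)

/-- `ΔY_i^pre(g)`. -/
def dYpre (i g : ℕ) (ω : Ω) : Finset.Ico 2 g → ℝ := fun s => M.Y i s ω - M.Y i (s - 1) ω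

/-- `Δe_i^pre(g)`. -/
def dEpre (i g : ℕ) (ω : Ω) : Finset.Ico 2 g → ℝ := fun s => M.e i s ω - M.e i (s - 1) ω

/-- `ℓ_i^comp(g,t)`, the vector of `1{G_i = g'} / p_{g'}` over the comparison groups `g'`. -/
def ell (i t : ℕ) (ω : Ω) : M.comp μ t → ℝ :=
  fun g' => (if M.group i ω = (g' : ℕ∞) then 1 else 0) / M.p μ g'

/-- `Λ^comp(g,t) = E[ℓ^comp(g,t) (1, λ')]`. -/
def LambdaComp (t : ℕ) : Matrix (M.comp μ t) (Fin (R + 1)) ℝ :=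
  Matrix.of fun g' j =>
    ∫ ω, M.ell μ 0 t ω g' * (Fin.cons 1 (M.lam 0 ω) : Fin (R + 1) → ℝ) j ∂μ

/-- Rank conditions on the factors and on the loadings, for each identified pair. -/
def RankConditions : Prop :=
  ∀ k ∈ M.identified μ, (M.dFpre k.1).rank = R ∧ (M.LambdaComp μ k.2).rank = R + 1

variable (Om : (g : ℕ) → Matrix (Finset.Ico 2 g) (Fin R) ℝ)

/-- The known matrices `𝛀 = Om g` have rank `R` and `Rank(𝛀' ΔF^pre(g)) = Rank(ΔF^pre(g))`. -/
def ValidOmega : Prop :=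
  ∀ k ∈ M.identified μ,
    (Om k.1).rank = R ∧ ((Om k.1)ᵀ * M.dFpre k.1).rank = (M.dFpre k.1).rank

/-- `H^pre(g) = (𝛀' ΔF^pre(g))⁻¹ 𝛀'`. -/
def Hpre (g : ℕ) : Matrix (Fin R) (Finset.Ico 2 g) ℝ :=
  ((Om g)ᵀ * M.dFpre g)⁻¹ * (Om g)ᵀ

/-- `F*(g,t)`, with `F*(g,t)' = (F_t - F_{g-1})' (𝛀' ΔF^pre(g))⁻¹`. -/
def Fstar (g t : ℕ) : Fin R → ℝ :=
  (M.F t - M.F (g - 1)) ᵥ* ((Om g)ᵀ * M.dFpre g)⁻¹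

/-- `θ*(g,t) = (θ_t - θ_{g-1}) - (F_t - F_{g-1})' H^pre(g) Δθ^pre(g)`. -/
def thetaStar (g t : ℕ) : ℝ :=
  (M.θ t - M.θ (g - 1)) - (M.F t - M.F (g - 1)) ⬝ᵥ (M.Hpre Om g *ᵥ M.dThetaPre g)

/-- `δ*(g,t) = (θ*(g,t), F*(g,t)')'`. -/
def deltaStar (g t : ℕ) : Fin (R + 1) → ℝ := Fin.cons (M.thetaStar Om g t) (M.Fstar Om g t)

/-- `v_i(g,t) = (e_it - e_{i,g-1}) - (F_t - F_{g-1})' H^pre(g) Δe_i^pre(g)`. -/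
def v (i g t : ℕ) (ω : Ω) : ℝ :=
  (M.e i t ω - M.e i (g - 1) ω) -
    (M.F t - M.F (g - 1)) ⬝ᵥ (M.Hpre Om g *ᵥ M.dEpre i g ω)

/-- The regressor vector `(1, (𝛀' ΔY_i^pre(g))')'`. -/
def regressor (i g : ℕ) (ω : Ω) : Fin (R + 1) → ℝ :=
  Fin.cons 1 ((Om g)ᵀ *ᵥ M.dYpre i g ω)

/-- `A_i(g) = 1{G_i = g} (1, (𝛀' ΔY_i^pre(g))')'`. -/
def A (i g : ℕ) (ω : Ω) : Fin (R + 1) → ℝ :=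
  fun j => (if M.group i ω = (g : ℕ∞) then 1 else 0) * M.regressor Om i g ω j

/-- `E[A(g)]`. -/
def meanA (g : ℕ) : Fin (R + 1) → ℝ := fun j => ∫ ω, M.A Om 0 g ω j ∂μ

/-- `1{G_i = g} (Y_it - Y_{i,g-1})`. -/
def X (i g t : ℕ) (ω : Ω) : ℝ :=
  (if M.group i ω = (g : ℕ∞) then 1 else 0) * (M.Y i t ω - M.Y i (g - 1) ω)

/-- `Γ(g,t) = E[ℓ^comp(g,t) (1, (𝛀' ΔY^pre(g))')]`. -/
def Gam (g t : ℕ) : Matrix (M.comp μ t) (Fin (R + 1)) ℝ :=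
  Matrix.of fun g' j => ∫ ω, M.ell μ 0 t ω g' * M.regressor Om 0 g ω j ∂μ

/-! ### The estimators, based on units `0, …, n - 1` -/

/-- The sample average `𝔼_n[f_i]`. -/
def _root_.sampleMean {Ω : Type*} (n : ℕ) (f : ℕ → Ω → ℝ) (ω : Ω) : ℝ :=
  (n : ℝ)⁻¹ * ∑ i ∈ Finset.range n, f i ω

/-- `Γ̂(g,t)`. -/
def GamHat (g t n : ℕ) (ω : Ω) : Matrix (M.comp μ t) (Fin (R + 1)) ℝ :=
  Matrix.of fun g' j =>
    sampleMean n (fun i ω => M.ell μ i t ω g' * M.regressor Om i g ω j) ω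

/-- `𝔼_n[ℓ_i^comp(g,t) (Y_it - Y_{i,g-1})]`. -/
def momentHat (g t n : ℕ) (ω : Ω) : M.comp μ t → ℝ :=
  fun g' => sampleMean n (fun i ω => M.ell μ i t ω g' * (M.Y i t ω - M.Y i (g - 1) ω)) ω

variable (What : (g t n : ℕ) → Ω → Matrix (M.comp μ t) (M.comp μ t) ℝ)

/-- `δ̂*(g,t) = (Γ̂' Ŵ Γ̂)⁻¹ Γ̂' Ŵ 𝔼_n[ℓ_i^comp(g,t) (Y_it - Y_{i,g-1})]`. -/
def deltaHat (g t n : ℕ) (ω : Ω) : Fin (R + 1) → ℝ :=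
  (((M.GamHat μ Om g t n ω)ᵀ * What g t n ω * M.GamHat μ Om g t n ω)⁻¹ *
    (M.GamHat μ Om g t n ω)ᵀ * What g t n ω) *ᵥ M.momentHat μ g t n ω

/-- `p̂_g = 𝔼_n[1{G_i = g}]`. -/
def pHat (g n : ℕ) (ω : Ω) : ℝ :=
  sampleMean n (fun i ω => if M.group i ω = (g : ℕ∞) then 1 else 0) ω

/-- The estimator
`p̂_g⁻¹ { 𝔼_n[1{G_i = g}(Y_it - Y_{i,g-1})] - 𝔼_n[A_i(g)]' δ̂*(g,t) }` of `ATT(g,t)`. -/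
def ATTHat (g t n : ℕ) (ω : Ω) : ℝ :=
  (M.pHat g n ω)⁻¹ *
    (sampleMean n (fun i ω => M.X i g t ω) ω -
      (fun j => sampleMean n (fun i ω => M.A Om i g ω j) ω) ⬝ᵥ M.deltaHat μ Om What g t n ω)

/-! ### Influence functions -/

variable (W : (g t : ℕ) → Matrix (M.comp μ t) (M.comp μ t) ℝ)

/-- The weighting matrices: `W(g,t)` is positive definite, `Ŵ(g,t)` is a random matrix that
converges to it in probability (entrywise). -/
def WeightingConsistent : Prop :=
  ∀ k ∈ M.identified μ, (W k.1 k.2).PosDef ∧ ∀ a b : M.comp μ k.2,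
    (∀ n, AEMeasurable (fun ω => What k.1 k.2 n ω a b) μ) ∧
    TendstoInMeasure μ (fun n ω => What k.1 k.2 n ω a b) atTop (fun _ => W k.1 k.2 a b)

/-- `B(g,t) = (Γ' W Γ)⁻¹ Γ' W`. -/
def B (g t : ℕ) : Matrix (Fin (R + 1)) (M.comp μ t) ℝ :=
  ((M.Gam μ Om g t)ᵀ * W g t * M.Gam μ Om g t)⁻¹ * (M.Gam μ Om g t)ᵀ * W g t

/-- `ψ⁽¹⁾`: estimation of the mean outcome change of group `g`. -/
def psi1 (i g t : ℕ) (ω : Ω) : ℝ :=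
  (M.X i g t ω - ∫ ω', M.X 0 g t ω' ∂μ) / M.p μ g

/-- `ψ⁽²⁾`: estimation of `δ*(g,t)`. -/
def psi2 (i g t : ℕ) (ω : Ω) : ℝ :=
  -((M.meanA μ Om g ⬝ᵥ (M.B μ Om W g t *ᵥ fun g' => M.ell μ i t ω g' * M.v Om i g t ω)) /
    M.p μ g)

/-- `ψ⁽³⁾`: estimation of `E[A(g)]`. -/
def psi3 (i g t : ℕ) (ω : Ω) : ℝ :=
  -((M.deltaStar Om g t ⬝ᵥ (M.A Om i g ω - M.meanA μ Om g)) / M.p μ g)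

/-- `ψ⁽⁴⁾`: estimation of `p_g`. -/
def psi4 (i g t : ℕ) (ω : Ω) : ℝ :=
  -(M.ATT μ g t / M.p μ g * ((if M.group i ω = (g : ℕ∞) then 1 else 0) - M.p μ g))

/-- `ψ_igt = ψ⁽¹⁾ + ψ⁽²⁾ + ψ⁽³⁾ + ψ⁽⁴⁾`. -/
def psi (i g t : ℕ) (ω : Ω) : ℝ :=
  M.psi1 μ i g t ω + M.psi2 μ Om W i g t ω + M.psi3 μ Om i g t ω + M.psi4 μ i g t ω

/-! ### Stacked vectors over the identified pairs -/

/-- The vector `ATT`. -/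
def ATTvec : EuclideanSpace ℝ (M.identified μ) :=
  WithLp.toLp 2 fun k => M.ATT μ k.1.1 k.1.2

/-- The vector of estimators. -/
def ATTHatVec (n : ℕ) (ω : Ω) : EuclideanSpace ℝ (M.identified μ) :=
  WithLp.toLp 2 fun k => M.ATTHat μ Om What k.1.1 k.1.2 n ω

/-- The influence vector `Ψ_i`. -/
def Psi (i : ℕ) (ω : Ω) : EuclideanSpace ℝ (M.identified μ) :=
  WithLp.toLp 2 fun k => M.psi μ Om W i k.1.1 k.1.2 ω

/-- `E[Ψ Ψ']`. -/
def PsiCov : Matrix (M.identified μ) (M.identified μ) ℝ :=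
  Matrix.of fun k l => ∫ ω, M.Psi μ Om W 0 ω k * M.Psi μ Om W 0 ω l ∂μ

/-- `w'Ψ_i + ATT'𝒲_i`, the influence function of an aggregated parameter with weights `w` and
influence vectors `𝒲_i` of the estimated weights. -/
def aggInfluence (w : EuclideanSpace ℝ (M.identified μ))
    (Winf : ℕ → Ω → EuclideanSpace ℝ (M.identified μ)) (i : ℕ) (ω : Ω) : ℝ :=
  ∑ k, w k * M.Psi μ Om W i ω k + ∑ k, M.ATTvec μ k * Winf i ω k

end PanelModel

end

/-!
The estimator of `ATT(g,t)` is asymptotically linear because the interactive fixed effects can be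
differenced away.  A unit that is untreated before period `g` has pre-treatment differences
`ΔY^pre = Δθ^pre + ΔF^pre λ + Δe^pre`; as `𝛀' ΔF^pre` is invertible, `λ` can be solved for, and the
untreated outcome change from `g - 1` to `t` becomes `δ*(g,t)' Z(g) + v(g,t)`
(`PanelModel.deltaStar_dotProduct_regressor_add_v`).  Unconfoundedness makes the errors, and so
`v(g,t)`, have mean zero on every group (`PanelModel.groupCentered_e`).  Therefore `δ*(g,t)` solves the
moment equations of the comparison groups, whose matrix `Γ(g,t)` inherits full column rank from
`Λ^comp(g,t)` (`PanelModel.Gam_mulVec_injective`), and `ATT(g,t)` is identified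
(`PanelModel.p_mul_ATT`).

Substituting the moment equations into the estimator gives, wherever the inverses exist, the exact
expansion `PanelModel.ATTHat_sub_ATT`: a linear combination of two sample means of centred square
integrable functions of the observed data, with random coefficients that are consistent by the law of
large numbers and continuity of matrix inversion.  The influence function is the same combination
with the limiting coefficients (`PanelModel.ae_psi_eq`), so the remainder is `o_p(1)` times normalised
sums of bounded second moment, hence negligible (`PanelModel.tendsto_ATTHat_remainder`).

Convergence in probability is treated as convergence along the filter `inProb μ`.  Asymptotic normality
is the multivariate central limit theorem `tendstoInDistribution_inv_sqrt_smul_sum`, obtained from the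
one-dimensional one by the Cramér–Wold device and Lévy's continuity theorem, together with Slutsky's
theorem.  The aggregated parameter follows from the product rule for asymptotically linear
estimators.
-/

open MeasureTheory ProbabilityTheory Filter Topology Matrix

noncomputable section

/-! ### Convergence in probability as convergence along a filter -/

section ConvergenceInProbability

variable {Ω : Type*} [MeasurableSpace Ω] {μ : Measure Ω}

/-- The filter on `ℕ × Ω` of events of probability tending to one: a set belongs to it if its sections
at `n` have complements of measure tending to zero.  Convergence in probability to a constant is
convergence along this filter (`tendstoInMeasure_const_iff`), so that the continuous mapping theorem
and "with probability tending to one" are ordinary statements about `Tendsto` and `∀ᶠ`. -/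
def inProb (μ : Measure Ω) : Filter (ℕ × Ω) where
  sets := {S | Tendsto (fun n => μ {ω | (n, ω) ∉ S}) atTop (𝓝 0)}
  univ_sets := by simp
  sets_of_superset {S S'} h hsub := by
    refine tendsto_of_tendsto_of_tendsto_of_le_of_le tendsto_const_nhds h (fun _ => zero_le)
      fun n => measure_mono fun ω hω hS => hω (hsub hS)
  inter_sets {S S'} h h' := by
    have h2 := Tendsto.add h h'
    rw [add_zero] at h2
    refine tendsto_of_tendsto_of_tendsto_of_le_of_le tendsto_const_nhds h2 (fun _ => zero_le)
      fun n => le_trans (measure_mono ?_) (measure_union_le _ _)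
    intro ω hω
    simp only [Set.mem_inter_iff, Set.mem_ofPred_eq, not_and_or] at hω
    exact hω

theorem eventually_inProb {P : ℕ × Ω → Prop} :
    (∀ᶠ x in inProb μ, P x) ↔ Tendsto (fun n => μ {ω | ¬ P (n, ω)}) atTop (𝓝 0) := Iff.rfl

theorem eventually_inProb_of_ae {P : ℕ × Ω → Prop} (h : ∀ n, ∀ᵐ ω ∂μ, P (n, ω)) :
    ∀ᶠ x in inProb μ, P x := by
  rw [eventually_inProb]
  have : ∀ n, μ {ω | ¬ P (n, ω)} = 0 := fun n => h n
  simp [this]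

theorem tendstoInMeasure_const_iff {E : Type*} [PseudoMetricSpace E] {f : ℕ → Ω → E} {c : E} :
    TendstoInMeasure μ f atTop (fun _ => c) ↔
      Tendsto (fun x : ℕ × Ω => f x.1 x.2) (inProb μ) (𝓝 c) := by
  rw [tendstoInMeasure_iff_dist, Metric.tendsto_nhds]
  refine forall₂_congr fun ε _ => ?_
  rw [eventually_inProb]
  simp only [not_lt]

/-- `o_p(1) · O_p(1) = o_p(1)`, where `O_p(1)` comes from bounded second moments by Chebyshev's
inequality. -/
theorem tendsto_mul_of_secondMoment_bdd {f S : ℕ → Ω → ℝ} {C : ℝ}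
    (hf : Tendsto (fun x : ℕ × Ω => f x.1 x.2) (inProb μ) (𝓝 0))
    (hint : ∀ n, Integrable (fun ω => S n ω ^ 2) μ) (hC : ∀ n, ∫ ω, S n ω ^ 2 ∂μ ≤ C) :
    Tendsto (fun x : ℕ × Ω => f x.1 x.2 * S x.1 x.2) (inProb μ) (𝓝 0) := by
  have cheb : ∀ (K : ℝ), 0 < K → ∀ n, μ {ω | K ≤ S n ω ^ 2} ≤ ENNReal.ofReal (C / K) := by
    intro K hK n
    have h1 := meas_ge_le_lintegral_div (μ := μ) (f := fun ω => ENNReal.ofReal (S n ω ^ 2))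
      (hint n).aemeasurable.ennreal_ofReal (ε := ENNReal.ofReal K) (by simpa using hK) (by simp)
    rw [← ofReal_integral_eq_lintegral_ofReal (hint n) (ae_of_all _ fun ω => sq_nonneg _),
      ← ENNReal.ofReal_div_of_pos hK] at h1
    refine le_trans (measure_mono fun ω hω => ?_) (h1.trans (ENNReal.ofReal_le_ofReal ?_))
    · exact ENNReal.ofReal_le_ofReal hω
    · exact div_le_div_of_nonneg_right (hC n) hK.le
  -- choose the level `√K` of `S` with small exceedance probability; below it `f` has to exceed `ε / √K`
  rw [Metric.tendsto_nhds]
  intro ε hε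
  rw [eventually_inProb, ENNReal.tendsto_nhds_zero]
  intro δ hδ
  obtain ⟨K, hK, hKδ⟩ : ∃ K : ℝ, 0 < K ∧ ENNReal.ofReal (C / K) ≤ δ / 2 := by
    have : Tendsto (fun K : ℝ => ENNReal.ofReal (C / K)) atTop (𝓝 0) := by
      have h := (tendsto_const_nhds (x := C)).div_atTop tendsto_id
      simpa [Function.comp_def] using (ENNReal.continuous_ofReal.tendsto 0).comp h
    have h2 := (ENNReal.tendsto_nhds_zero.1 this (δ / 2) (ENNReal.half_pos hδ.ne'))
    obtain ⟨K, h, h'⟩ := (h2.and (eventually_gt_atTop 0)).exists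
    exact ⟨K, h', h⟩
  have hs : 0 < √K := Real.sqrt_pos.2 hK
  have hf' := (eventually_inProb (P := fun x => dist (f x.1 x.2) 0 < ε / √K)).1
    (Metric.tendsto_nhds.1 hf (ε / √K) (by positivity))
  filter_upwards [ENNReal.tendsto_nhds_zero.1 hf' (δ / 2) (ENNReal.half_pos hδ.ne')] with n hn
  calc _ ≤ μ ({ω | ¬ dist (f n ω) 0 < ε / √K} ∪ {ω | K ≤ S n ω ^ 2}) := by
        refine measure_mono fun ω hω => ?_
        by_contra hcon
        simp only [Set.mem_union, Set.mem_ofPred_eq, not_or, not_not, not_le, dist_zero_right,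
          Real.norm_eq_abs] at hcon
        refine hω ?_
        simp only [dist_zero_right, Real.norm_eq_abs, abs_mul]
        have : |S n ω| < √K := by
          rw [← Real.sqrt_sq_eq_abs]; exact Real.sqrt_lt_sqrt (sq_nonneg _) hcon.2
        calc |f n ω| * |S n ω| ≤ |f n ω| * √K := by gcongr
          _ < ε / √K * √K := by gcongr; exact hcon.1
          _ = ε := by field_simp
    _ ≤ δ / 2 + δ / 2 := (measure_union_le _ _).trans (add_le_add hn ((cheb K hK n).trans hKδ))
    _ = δ := ENNReal.add_halves δ

theorem tendstoInMeasure_euclideanSpace {Ω ι : Type*} [MeasurableSpace Ω] [Fintype ι]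
    {μ : Measure Ω} {f : ℕ → Ω → EuclideanSpace ℝ ι} {c : EuclideanSpace ℝ ι} :
    TendstoInMeasure μ f atTop (fun _ => c) ↔
      ∀ k, Tendsto (fun x : ℕ × Ω => f x.1 x.2 k) (inProb μ) (𝓝 (c k)) := by
  rw [tendstoInMeasure_const_iff]
  refine ⟨fun h k => ((EuclideanSpace.proj (𝕜 := ℝ) k).continuous.tendsto c).comp h, fun h => ?_⟩
  exact ((PiLp.continuous_toLp 2 fun _ : ι => ℝ).tendsto _).comp (tendsto_pi_nhds.2 h)

end ConvergenceInProbability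

/-! ### Sample means and limit theorems for iid sequences -/

section SampleMean

variable {Ω : Type*} {f h : ℕ → Ω → ℝ}

theorem sampleMean_sub (n : ℕ) (ω : Ω) :
    sampleMean n (fun i ω => f i ω - h i ω) ω = sampleMean n f ω - sampleMean n h ω := by
  simp only [sampleMean, Finset.sum_sub_distrib, mul_sub]

theorem sampleMean_const_mul (c : ℝ) (n : ℕ) (ω : Ω) :
    sampleMean n (fun i ω => c * f i ω) ω = c * sampleMean n f ω := by
  simp only [sampleMean, ← Finset.mul_sum]
  ring

theorem sampleMean_dotProduct {ι : Type*} [Fintype ι] (c : ι → ℝ) (f : ℕ → Ω → ι → ℝ) (n : ℕ)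
    (ω : Ω) : sampleMean n (fun i ω => c ⬝ᵥ f i ω) ω =
      c ⬝ᵥ fun k => sampleMean n (fun i ω => f i ω k) ω := by
  simp only [sampleMean, dotProduct, Finset.mul_sum]
  rw [Finset.sum_comm]
  exact Finset.sum_congr rfl fun k _ => Finset.sum_congr rfl fun i _ => by ring

theorem sqrt_mul_sampleMean (n : ℕ) (ω : Ω) :
    √(n : ℝ) * sampleMean n f ω = (√(n : ℝ))⁻¹ * ∑ i ∈ Finset.range n, f i ω := by
  rw [sampleMean, ← mul_assoc]
  congr 1
  -- for `n = 0` both factors vanish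
  rcases Nat.eq_zero_or_pos n with rfl | hn
  · simp
  · have : 0 < √(n : ℝ) := Real.sqrt_pos.2 (by exact_mod_cast hn)
    have h2 : √(n : ℝ) ^ 2 = n := Real.sq_sqrt (Nat.cast_nonneg n)
    rw [← h2]
    simp only [Real.sqrt_sq this.le]
    field_simp

theorem aemeasurable_sampleMean [MeasurableSpace Ω] {μ : Measure Ω}
    (hf : ∀ i, AEMeasurable (f i) μ) (n : ℕ) : AEMeasurable (fun ω => sampleMean n f ω) μ :=
  (Finset.aemeasurable_fun_sum _ fun i _ => hf i).const_mul _

end SampleMean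

section LimitTheorems

variable {Ω : Type*} [MeasurableSpace Ω] {μ : Measure Ω} [IsProbabilityMeasure μ]

theorem tendsto_sampleMean_inProb {X : ℕ → Ω → ℝ} (hindep : iIndepFun X μ)
    (hident : ∀ i, IdentDistrib (X i) (X 0) μ μ) (hint : Integrable (X 0) μ) :
    Tendsto (fun x : ℕ × Ω => sampleMean x.1 X x.2) (inProb μ) (𝓝 (∫ ω, X 0 ω ∂μ)) := by
  refine (tendstoInMeasure_const_iff (f := fun n ω => sampleMean n X ω)).1
    (tendstoInMeasure_of_tendsto_ae (fun n => ?_) ?_)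
  · have : ∀ i, AEStronglyMeasurable (X i) μ := fun i => (hident i).aemeasurable_fst.aestronglyMeasurable
    exact (Finset.aestronglyMeasurable_fun_sum _ fun i _ => this i).const_mul _
  · filter_upwards [strong_law_ae X hint (fun i j hij => hindep.indepFun hij) hident] with ω hω
    simpa only [sampleMean, smul_eq_mul] using hω

/-- The second moment of `n^{-1/2} ∑ X_i` is that of `X_0` (and is `0` for `n = 0`). -/
theorem integral_sq_inv_sqrt_mul_sum_le {X : ℕ → Ω → ℝ} (hindep : iIndepFun X μ)
    (hident : ∀ i, IdentDistrib (X i) (X 0) μ μ) (hL2 : MemLp (X 0) 2 μ)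
    (h0 : ∫ ω, X 0 ω ∂μ = 0) (n : ℕ) :
    Integrable (fun ω => ((√(n : ℝ))⁻¹ * ∑ i ∈ Finset.range n, X i ω) ^ 2) μ ∧
    ∫ ω, ((√(n : ℝ))⁻¹ * ∑ i ∈ Finset.range n, X i ω) ^ 2 ∂μ ≤ ∫ ω, X 0 ω ^ 2 ∂μ := by
  have hm : ∀ i, MemLp (X i) 2 μ := fun i => (hident i).memLp_iff.2 hL2
  have hsum : MemLp (fun ω => ∑ i ∈ Finset.range n, X i ω) 2 μ :=
    memLp_finsetSum _ fun i _ => hm i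
  refine ⟨(hsum.const_mul _).integrable_sq, ?_⟩
  simp_rw [mul_pow]
  rw [integral_const_mul]
  have hmean : ∫ ω, (∑ i ∈ Finset.range n, X i) ω ∂μ = 0 := by
    simp only [Finset.sum_apply]
    rw [integral_finsetSum _ fun i _ => (hm i).integrable one_le_two]
    exact Finset.sum_eq_zero fun i _ => (hident i).integral_eq.trans h0
  have hvar := IndepFun.variance_sum (s := Finset.range n) (fun i _ => hm i)
    (fun i _ j _ hij => hindep.indepFun hij)
  have hv0 : ∀ i, Var[X i; μ] = ∫ ω, X 0 ω ^ 2 ∂μ := by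
    intro i
    rw [(hident i).variance_eq, variance_of_integral_eq_zero hL2.aemeasurable h0]
  rw [variance_of_integral_eq_zero (by
    have := hsum.aemeasurable
    convert this using 1; ext ω; simp) hmean] at hvar
  simp only [Finset.sum_apply, hv0, Finset.sum_const, Finset.card_range, nsmul_eq_mul] at hvar
  rw [hvar]
  have hnn : 0 ≤ ∫ ω, X 0 ω ^ 2 ∂μ := integral_nonneg fun ω => sq_nonneg _
  rcases Nat.eq_zero_or_pos n with rfl | hn
  · simpa using hnn
  · rw [inv_pow, Real.sq_sqrt (Nat.cast_nonneg n)]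
    have : (n : ℝ) ≠ 0 := by positivity
    rw [inv_mul_cancel_left₀ this]

/-- A factor converging to zero in probability times a normalised sum of centred, square integrable
iid variables is negligible. -/
theorem tendsto_mul_inv_sqrt_mul_sum {X : ℕ → Ω → ℝ} (hindep : iIndepFun X μ)
    (hident : ∀ i, IdentDistrib (X i) (X 0) μ μ) (hL2 : MemLp (X 0) 2 μ)
    (h0 : ∫ ω, X 0 ω ∂μ = 0) {f : ℕ × Ω → ℝ} (hf : Tendsto f (inProb μ) (𝓝 0)) :
    Tendsto (fun x : ℕ × Ω => f x * ((√(x.1 : ℝ))⁻¹ * ∑ i ∈ Finset.range x.1, X i x.2))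
      (inProb μ) (𝓝 0) :=
  tendsto_mul_of_secondMoment_bdd (f := fun n ω => f (n, ω))
    (S := fun n ω => (√(n : ℝ))⁻¹ * ∑ i ∈ Finset.range n, X i ω) hf
    (fun n => (integral_sq_inv_sqrt_mul_sum_le hindep hident hL2 h0 n).1)
    (fun n => (integral_sq_inv_sqrt_mul_sum_le hindep hident hL2 h0 n).2)

theorem tendsto_mul_sqrt_mul_sampleMean {X : ℕ → Ω → ℝ} (hindep : iIndepFun X μ)
    (hident : ∀ i, IdentDistrib (X i) (X 0) μ μ) (hL2 : MemLp (X 0) 2 μ)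
    (h0 : ∫ ω, X 0 ω ∂μ = 0) {f : ℕ × Ω → ℝ} (hf : Tendsto f (inProb μ) (𝓝 0)) :
    Tendsto (fun x : ℕ × Ω => f x * (√(x.1 : ℝ) * sampleMean x.1 X x.2)) (inProb μ) (𝓝 0) := by
  simp only [sqrt_mul_sampleMean]
  exact tendsto_mul_inv_sqrt_mul_sum hindep hident hL2 h0 hf

theorem tendstoInDistribution_inv_sqrt_mul_sum_centered {X : ℕ → Ω → ℝ} (hindep : iIndepFun X μ)
    (hident : ∀ i, IdentDistrib (X i) (X 0) μ μ) (hL2 : MemLp (X 0) 2 μ)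
    (h0 : ∫ ω, X 0 ω ∂μ = 0) :
    TendstoInDistribution (fun (n : ℕ) ω => (√(n : ℝ))⁻¹ * ∑ i ∈ Finset.range n, X i ω) atTop id
      (fun _ => μ) (gaussianReal 0 (∫ ω, X 0 ω ^ 2 ∂μ).toNNReal) := by
  have hv : Var[X 0; μ] = ∫ ω, X 0 ω ^ 2 ∂μ :=
    variance_of_integral_eq_zero hL2.aemeasurable h0
  have h := tendstoInDistribution_inv_sqrt_mul_sum_sub (Y := id) (X := X) (P := μ)
    (P' := gaussianReal 0 Var[X 0; μ].toNNReal) ⟨aemeasurable_id, Measure.map_id⟩ hL2 hindep hident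
  simp only [h0, mul_zero, sub_zero] at h
  rwa [hv] at h

/-- The multivariate central limit theorem for centred, square integrable iid vectors. -/
theorem tendstoInDistribution_inv_sqrt_smul_sum {ι : Type*} [Fintype ι] [DecidableEq ι]
    {X : ℕ → Ω → EuclideanSpace ℝ ι} (hindep : iIndepFun X μ)
    (hident : ∀ i, IdentDistrib (X i) (X 0) μ μ) (hL2 : MemLp (X 0) 2 μ)
    (h0 : ∫ ω, X 0 ω ∂μ = 0) :
    TendstoInDistribution (fun (n : ℕ) ω => (√(n : ℝ))⁻¹ • ∑ i ∈ Finset.range n, X i ω) atTop id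
      (fun _ => μ)
      (multivariateGaussian 0 (Matrix.of fun k l => ∫ ω, X 0 ω k * X 0 ω l ∂μ)) := by
  have hcomp : ∀ k, MemLp (fun ω => X 0 ω k) 2 μ := fun k =>
    (EuclideanSpace.proj (𝕜 := ℝ) k).comp_memLp' hL2
  have hprod : ∀ k l, Integrable (fun ω => X 0 ω k * X 0 ω l) μ := fun k l =>
    (hcomp k).integrable_mul (hcomp l)
  set S : Matrix ι ι ℝ := Matrix.of fun k l => ∫ ω, X 0 ω k * X 0 ω l ∂μ with hS
  have hquad : ∀ t : ι → ℝ, t ⬝ᵥ S *ᵥ t = ∫ ω, (∑ k, X 0 ω k * t k) ^ 2 ∂μ := by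
    intro t
    have : ∀ ω, (∑ k, X 0 ω k * t k) ^ 2 = ∑ k, ∑ l, t k * t l * (X 0 ω k * X 0 ω l) := by
      intro ω
      rw [sq, Finset.sum_mul_sum]
      exact Finset.sum_congr rfl fun k _ => Finset.sum_congr rfl fun l _ => by ring
    simp_rw [this]
    rw [integral_finsetSum _ fun k _ => integrable_finsetSum _ fun l _ => (hprod k l).const_mul _]
    simp only [dotProduct, mulVec, Finset.mul_sum]
    refine Finset.sum_congr rfl fun k _ => ?_
    rw [integral_finsetSum _ fun l _ => (hprod k l).const_mul _]
    refine Finset.sum_congr rfl fun l _ => ?_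
    rw [integral_const_mul, hS, Matrix.of_apply]; ring
  have hpsd : S.PosSemidef := by
    refine Matrix.PosSemidef.of_dotProduct_mulVec_nonneg ?_ fun t => ?_
    · ext k l
      simp [hS, mul_comm]
    · rw [star_trivial, hquad]
      exact integral_nonneg fun ω => sq_nonneg _
  have haem : ∀ n : ℕ, AEMeasurable
      (fun ω => (√(n : ℝ))⁻¹ • ∑ i ∈ Finset.range n, X i ω) μ := fun n =>
    AEMeasurable.fun_const_smul
      (Finset.aemeasurable_fun_sum _ fun i _ => (hident i).aemeasurable_fst) _
  refine ⟨haem, aemeasurable_id, ?_⟩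
  refine ProbabilityMeasure.tendsto_iff_tendsto_charFun.2 fun t => ?_
  -- the Cramér–Wold device: reduce to the scalar sums `⟨X i, t⟩`
  have hmeas : Measurable fun x : EuclideanSpace ℝ ι => inner ℝ x t := by fun_prop
  have h1 := tendstoInDistribution_inv_sqrt_mul_sum_centered (μ := μ)
    (X := fun i ω => inner ℝ (X i ω) t) (hindep.comp (fun _ x => inner ℝ x t) fun _ => hmeas)
    (fun i => (hident i).comp hmeas) (hL2.inner_const t)
    (by
      have h := integral_inner (𝕜 := ℝ) (hL2.integrable one_le_two) t
      simp only [real_inner_comm t] at h ⊢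
      rw [h, h0, inner_zero_right])
  have h2 := (ProbabilityMeasure.tendsto_iff_tendsto_charFun.1 h1.tendsto) 1
  simp only [ProbabilityMeasure.coe_mk, Measure.map_id] at h2 ⊢
  rw [charFun_multivariateGaussian hpsd]
  have hl : ∀ n : ℕ, charFun (μ.map fun ω => (√(n : ℝ))⁻¹ • ∑ i ∈ Finset.range n, X i ω) t =
      charFun (μ.map fun ω => (√(n : ℝ))⁻¹ * ∑ i ∈ Finset.range n, inner ℝ (X i ω) t) 1 := by
    intro n
    have hm2 : AEMeasurable
        (fun ω => (√(n : ℝ))⁻¹ * ∑ i ∈ Finset.range n, inner ℝ (X i ω) t) μ :=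
      h1.forall_aemeasurable n
    rw [charFun_apply, charFun_apply, integral_map (haem n) (by fun_prop),
      integral_map hm2 (by fun_prop)]
    refine integral_congr_ae (ae_of_all _ fun ω => ?_)
    simp [inner_smul_left, sum_inner]
  simp_rw [hl]
  have hnn : 0 ≤ ∫ ω, (inner ℝ (X 0 ω) t) ^ 2 ∂μ := integral_nonneg fun ω => sq_nonneg _
  have hq : (t : ι → ℝ) ⬝ᵥ S *ᵥ t = ∫ ω, (inner ℝ (X 0 ω) t) ^ 2 ∂μ := by
    rw [hquad]
    simp [PiLp.inner_apply, mul_comm]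
  rw [charFun_gaussianReal] at h2
  simpa [hq, Real.coe_toNNReal _ hnn] using h2

end LimitTheorems

/-! ### Statistics of the data of single units -/

section UnitStatistics

variable {Ω 𝒳 E E' : Type*} [MeasurableSpace Ω] [MeasurableSpace 𝒳] [MeasurableSpace E]
  [MeasurableSpace E'] {μ : Measure Ω} {O : ℕ → Ω → 𝒳}

/-- `f i` is, almost surely, the same measurable function of the data `O i` for each unit `i`.  Such
a sequence inherits independence and identical distribution from the data. -/
def IsUnitStatistic (μ : Measure Ω) (O : ℕ → Ω → 𝒳) (f : ℕ → Ω → E) : Prop :=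
  ∃ h : 𝒳 → E, Measurable h ∧ ∀ i, f i =ᵐ[μ] h ∘ O i

namespace IsUnitStatistic

theorem congr {f g : ℕ → Ω → E} (hf : IsUnitStatistic μ O f) (h : ∀ i, g i =ᵐ[μ] f i) :
    IsUnitStatistic μ O g := by
  obtain ⟨φ, hφ, hf⟩ := hf
  exact ⟨φ, hφ, fun i => (h i).trans (hf i)⟩

theorem of_comp {φ : 𝒳 → E} (hφ : Measurable φ) :
    IsUnitStatistic μ O fun i ω => φ (O i ω) :=
  ⟨φ, hφ, fun _ => EventuallyEq.rfl⟩

theorem comp {f : ℕ → Ω → E} (hf : IsUnitStatistic μ O f) {u : E → E'} (hu : Measurable u) :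
    IsUnitStatistic μ O fun i ω => u (f i ω) := by
  obtain ⟨φ, hφ, hf⟩ := hf
  exact ⟨u ∘ φ, hu.comp hφ, fun i => (hf i).fun_comp u⟩

theorem of_data {𝒳' : Type*} [MeasurableSpace 𝒳'] {O' : ℕ → Ω → 𝒳'} {f : ℕ → Ω → E}
    (hf : IsUnitStatistic μ O f) {π : 𝒳' → 𝒳} (hπ : Measurable π) (h : ∀ i, O i = π ∘ O' i) :
    IsUnitStatistic μ O' f := by
  obtain ⟨φ, hφ, hf⟩ := hf
  refine ⟨φ ∘ π, hφ.comp hπ, fun i => ?_⟩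
  simpa [h i, Function.comp_def] using hf i

theorem pi {ι : Type*} [Countable ι] {F : ι → Type*} [∀ k, MeasurableSpace (F k)]
    {f : ℕ → Ω → ∀ k, F k} (hf : ∀ k, IsUnitStatistic μ O fun i ω => f i ω k) :
    IsUnitStatistic μ O f := by
  choose φ hφ hf using hf
  refine ⟨fun x k => φ k x, measurable_pi_lambda _ hφ, fun i => ?_⟩
  filter_upwards [ae_all_iff.2 fun k => hf k i] with ω hω
  exact funext hω

theorem prodMk {f : ℕ → Ω → E} {g : ℕ → Ω → E'} (hf : IsUnitStatistic μ O f)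
    (hg : IsUnitStatistic μ O g) : IsUnitStatistic μ O fun i ω => (f i ω, g i ω) := by
  obtain ⟨φ, hφ, hf⟩ := hf
  obtain ⟨γ, hγ, hg⟩ := hg
  exact ⟨fun x => (φ x, γ x), hφ.prodMk hγ, fun i => (hf i).prodMk (hg i)⟩

theorem const (c : E) : IsUnitStatistic μ O fun _ _ => c :=
  ⟨fun _ => c, measurable_const, fun _ => EventuallyEq.rfl⟩

theorem add {f g : ℕ → Ω → ℝ} (hf : IsUnitStatistic μ O f) (hg : IsUnitStatistic μ O g) :
    IsUnitStatistic μ O fun i ω => f i ω + g i ω :=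
  (hf.prodMk hg).comp (u := fun x : ℝ × ℝ => x.1 + x.2) (by fun_prop)

theorem sub {f g : ℕ → Ω → ℝ} (hf : IsUnitStatistic μ O f) (hg : IsUnitStatistic μ O g) :
    IsUnitStatistic μ O fun i ω => f i ω - g i ω :=
  (hf.prodMk hg).comp (u := fun x : ℝ × ℝ => x.1 - x.2) (by fun_prop)

theorem mul {f g : ℕ → Ω → ℝ} (hf : IsUnitStatistic μ O f) (hg : IsUnitStatistic μ O g) :
    IsUnitStatistic μ O fun i ω => f i ω * g i ω :=
  (hf.prodMk hg).comp (u := fun x : ℝ × ℝ => x.1 * x.2) (by fun_prop)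

theorem sum {ι : Type*} {s : Finset ι} {f : ι → ℕ → Ω → ℝ}
    (hf : ∀ k ∈ s, IsUnitStatistic μ O (f k)) :
    IsUnitStatistic μ O fun i ω => ∑ k ∈ s, f k i ω := by
  classical
  induction s using Finset.induction_on with
  | empty => simpa using const (0 : ℝ)
  | insert a s ha ih =>
    simp only [Finset.sum_insert ha]
    exact (hf a (Finset.mem_insert_self a s)).add
      (ih fun k hk => hf k (Finset.mem_insert_of_mem hk))

theorem euclideanSpace {ι : Type*} [Fintype ι] {f : ℕ → Ω → EuclideanSpace ℝ ι}
    (hf : ∀ k, IsUnitStatistic μ O fun i ω => f i ω k) : IsUnitStatistic μ O f :=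
  (IsUnitStatistic.pi (f := fun i ω k => f i ω k) hf).comp
    (u := fun x : ι → ℝ => WithLp.toLp 2 x) (by fun_prop)

theorem dotProduct {ι : Type*} [Fintype ι] (c : ι → ℝ) {f : ℕ → Ω → ι → ℝ}
    (hf : ∀ k, IsUnitStatistic μ O fun i ω => f i ω k) :
    IsUnitStatistic μ O fun i ω => c ⬝ᵥ f i ω :=
  sum fun k _ => (const (c k)).mul (hf k)

theorem aemeasurable {f : ℕ → Ω → E} (hf : IsUnitStatistic μ O f)
    (hident : ∀ i, IdentDistrib (O i) (O 0) μ μ) (i : ℕ) : AEMeasurable (f i) μ := by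
  obtain ⟨φ, hφ, hf⟩ := hf
  exact (hφ.comp_aemeasurable (hident i).aemeasurable_fst).congr (hf i).symm

theorem identDistrib {f : ℕ → Ω → E} (hf : IsUnitStatistic μ O f)
    (hident : ∀ i, IdentDistrib (O i) (O 0) μ μ) (i : ℕ) : IdentDistrib (f i) (f 0) μ μ := by
  have hm := hf.aemeasurable hident
  obtain ⟨φ, hφ, hf⟩ := hf
  exact ((IdentDistrib.of_ae_eq (hm i) (hf i)).trans ((hident i).comp hφ)).trans
    (IdentDistrib.of_ae_eq (hm 0) (hf 0)).symm

theorem iIndepFun {f : ℕ → Ω → E} (hf : IsUnitStatistic μ O f)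
    (hindep : ProbabilityTheory.iIndepFun O μ) : ProbabilityTheory.iIndepFun f μ := by
  obtain ⟨φ, hφ, hf⟩ := hf
  exact (hindep.comp (fun _ => φ) fun _ => hφ).congr fun i => (hf i).symm

end IsUnitStatistic

end UnitStatistics

/-! ### Integrals of linear combinations -/

section LinearCombinations

variable {Ω ι : Type*} [MeasurableSpace Ω] {μ : Measure Ω} [Fintype ι]

theorem memLp_dotProduct (c : ι → ℝ) {f : Ω → ι → ℝ}
    (hf : ∀ k, MemLp (fun ω => f ω k) 2 μ) : MemLp (fun ω => c ⬝ᵥ f ω) 2 μ :=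
  memLp_finsetSum _ fun k _ => (hf k).const_mul (c k)

theorem integral_mul_dotProduct (c : ι → ℝ) {h : Ω → ℝ} {f : Ω → ι → ℝ}
    (hf : ∀ k, Integrable (fun ω => h ω * f ω k) μ) :
    ∫ ω, h ω * (f ω ⬝ᵥ c) ∂μ = ∑ k, (∫ ω, h ω * f ω k ∂μ) * c k := by
  simp only [dotProduct, Finset.mul_sum, ← mul_assoc]
  rw [integral_finsetSum _ fun k _ => (hf k).mul_const _]
  simp only [integral_mul_const]

end LinearCombinations

/-! ### Rank conditions and weighted least squares -/

section LinearAlgebra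

theorem mulVec_injective_of_rank_eq {m : Type*} [Fintype m] {n : ℕ} {A : Matrix m (Fin n) ℝ}
    (h : A.rank = n) : Function.Injective A.mulVec := by
  rw [mulVec_injective_iff, linearIndependent_iff_card_eq_finrank_span, Fintype.card_fin]
  rw [rank_eq_finrank_span_cols] at h
  exact h.symm

theorem isUnit_det_of_rank_eq {n : ℕ} {A : Matrix (Fin n) (Fin n) ℝ}
    (h : A.rank = n) : IsUnit A.det :=
  (isUnit_iff_isUnit_det A).1 (mulVec_injective_iff_isUnit.1 (mulVec_injective_of_rank_eq h))

theorem isUnit_det_transpose_mul_mul {m n : Type*} [Fintype m] [Fintype n] [DecidableEq n]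
    {W : Matrix m m ℝ} (hW : W.PosDef) {A : Matrix m n ℝ} (hA : Function.Injective A.mulVec) :
    IsUnit (Aᵀ * W * A).det := by
  have h := hW.conjTranspose_mul_mul_same hA
  rw [conjTranspose_eq_transpose_of_trivial] at h
  exact isUnit_iff_ne_zero.2 h.det_pos.ne'

/-- The matrix `(A' W A)⁻¹ A' W` of the least squares problem with moment matrix `A` and weights `W`. -/
def gmmMatrix {m n : Type*} [Fintype m] [Fintype n] [DecidableEq n] (A : Matrix m n ℝ)
    (W : Matrix m m ℝ) : Matrix n m ℝ :=
  (Aᵀ * W * A)⁻¹ * Aᵀ * W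

theorem gmmMatrix_mul_self {m n : Type*} [Fintype m] [Fintype n] [DecidableEq n]
    {A : Matrix m n ℝ} {W : Matrix m m ℝ} (h : IsUnit (Aᵀ * W * A).det) :
    gmmMatrix A W * A = 1 := by
  rw [gmmMatrix, Matrix.mul_assoc, Matrix.mul_assoc, ← Matrix.mul_assoc Aᵀ,
    nonsing_inv_mul _ h]

theorem continuousAt_gmmMatrix {m n : Type*} [Fintype m] [Fintype n] [DecidableEq n]
    {A : Matrix m n ℝ} {W : Matrix m m ℝ} (h : IsUnit (Aᵀ * W * A).det) :
    ContinuousAt (fun x : Matrix m n ℝ × Matrix m m ℝ => gmmMatrix x.1 x.2) (A, W) := by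
  have hq : Continuous fun x : Matrix m n ℝ × Matrix m m ℝ => x.1ᵀ * x.2 * x.1 :=
    (continuous_fst.matrix_transpose.matrix_mul continuous_snd).matrix_mul continuous_fst
  have hcont : ContinuousAt Inv.inv (Aᵀ * W * A) := by
    refine continuousAt_matrix_inv _ ?_
    rw [Ring.inverse_eq_inv']
    exact continuousAt_inv₀ h.ne_zero
  have hinv : Tendsto (fun x : Matrix m n ℝ × Matrix m m ℝ => (x.1ᵀ * x.2 * x.1)⁻¹)
      (𝓝 (A, W)) (𝓝 (Aᵀ * W * A)⁻¹) := hcont.tendsto.comp (hq.tendsto (A, W))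
  have hmul : Continuous fun y : Matrix n n ℝ × Matrix m n ℝ × Matrix m m ℝ =>
      y.1 * y.2.1ᵀ * y.2.2 :=
    (continuous_fst.matrix_mul continuous_snd.fst.matrix_transpose).matrix_mul continuous_snd.snd
  have h3 := (hmul.tendsto ((Aᵀ * W * A)⁻¹, A, W)).comp (hinv.prodMk_nhds tendsto_id)
  simpa only [ContinuousAt, gmmMatrix, Function.comp_def, id] using h3

variable {Ω l m n : Type*} [MeasurableSpace Ω] {μ : Measure Ω}

theorem aemeasurable_matrix_mul_apply [Fintype m] {A : Ω → Matrix l m ℝ} {B : Ω → Matrix m n ℝ}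
    (hA : ∀ a b, AEMeasurable (fun ω => A ω a b) μ) (hB : ∀ a b, AEMeasurable (fun ω => B ω a b) μ)
    (a : l) (b : n) : AEMeasurable (fun ω => (A ω * B ω) a b) μ := by
  simp only [mul_apply]
  exact Finset.aemeasurable_fun_sum _ fun k _ => (hA a k).mul (hB k b)

theorem aemeasurable_matrix_det [Fintype n] [DecidableEq n] {A : Ω → Matrix n n ℝ}
    (hA : ∀ a b, AEMeasurable (fun ω => A ω a b) μ) : AEMeasurable (fun ω => (A ω).det) μ := by
  simp only [det_apply']
  exact Finset.aemeasurable_fun_sum _ fun σ _ =>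
    (Finset.aemeasurable_fun_prod _ fun i _ => hA (σ i) i).const_mul _

theorem aemeasurable_matrix_inv_apply [Fintype n] [DecidableEq n] {A : Ω → Matrix n n ℝ}
    (hA : ∀ a b, AEMeasurable (fun ω => A ω a b) μ) (a b : n) :
    AEMeasurable (fun ω => (A ω)⁻¹ a b) μ := by
  simp only [inv_def, Ring.inverse_eq_inv', Matrix.smul_apply, smul_eq_mul,
    Matrix.adjugate_apply]
  refine (aemeasurable_matrix_det hA).inv.mul (aemeasurable_matrix_det fun c d => ?_)
  rcases eq_or_ne c b with rfl | h
  · simp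
  · simpa [updateRow_ne h] using hA c d

theorem aemeasurable_gmmMatrix_apply [Fintype m] [Fintype n] [DecidableEq n]
    {A : Ω → Matrix m n ℝ} {W : Ω → Matrix m m ℝ}
    (hA : ∀ a j, AEMeasurable (fun ω => A ω a j) μ) (hW : ∀ a b, AEMeasurable (fun ω => W ω a b) μ)
    (j : n) (a : m) : AEMeasurable (fun ω => gmmMatrix (A ω) (W ω) j a) μ :=
  have hAt : ∀ j a, AEMeasurable (fun ω => (A ω)ᵀ j a) μ := fun j a => hA a j
  aemeasurable_matrix_mul_apply (aemeasurable_matrix_mul_apply (aemeasurable_matrix_inv_apply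
    (aemeasurable_matrix_mul_apply (aemeasurable_matrix_mul_apply hAt hW) hA)) hAt) hW j a

end LinearAlgebra

namespace PanelModel

/-! ### Elimination of the interactive fixed effects -/

section Outcomes

variable {Ω : Type*} {T R : ℕ} {M : PanelModel Ω T R}
  {Om : (g : ℕ) → Matrix (Finset.Ico 2 g) (Fin R) ℝ}

/-- The indicator `1{G_i = a}`. -/
def inGroup (M : PanelModel Ω T R) (i : ℕ) (a : ℕ∞) (ω : Ω) : ℝ :=
  if M.group i ω = a then 1 else 0

theorem inGroup_mul_congr {i : ℕ} {a : ℕ∞} {ω : Ω} {x y : ℝ} (h : M.group i ω = a → x = y) :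
    M.inGroup i a ω * x = M.inGroup i a ω * y := by
  unfold inGroup
  split_ifs with ha
  · rw [h ha]
  · simp

theorem inGroup_mul_eq_indicator (a : ℕ∞) (f : Ω → ℝ) :
    (fun ω => M.inGroup 0 a ω * f ω) = {ω | M.group 0 ω = a}.indicator f := by
  ext ω
  by_cases h : M.group 0 ω = a <;> simp [inGroup, h]

/-- The observed outcome of unit `i` in period `s` follows the interactive fixed effects equation of
the untreated outcome. -/
def Untreated (M : PanelModel Ω T R) (i s : ℕ) (ω : Ω) : Prop :=
  M.Y i s ω = M.θ s + M.η i ω + M.lam i ω ⬝ᵥ M.F s + M.e i s ω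

theorem dYpre_eq {i g : ℕ} {ω : Ω} (h : ∀ s ∈ Finset.Ico 1 g, M.Untreated i s ω) :
    M.dYpre i g ω = M.dThetaPre g + M.dFpre g *ᵥ M.lam i ω + M.dEpre i g ω := by
  ext ⟨s, hs⟩
  obtain ⟨h2, hg⟩ := Finset.mem_Ico.1 hs
  have e1 := h s (Finset.mem_Ico.2 ⟨by omega, hg⟩)
  have e2 := h (s - 1) (Finset.mem_Ico.2 ⟨by omega, by omega⟩)
  rw [Untreated] at e1 e2
  have e3 : (M.dFpre g *ᵥ M.lam i ω) ⟨s, hs⟩ =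
      M.lam i ω ⬝ᵥ M.F s - M.lam i ω ⬝ᵥ M.F (s - 1) := by
    rw [← dotProduct_sub, dotProduct_comm]
    rfl
  simp only [dYpre, Pi.add_apply, dThetaPre, dEpre, e1, e2, e3]
  ring

theorem Hpre_mulVec_dFpre_mulVec {g : ℕ} (hQ : IsUnit ((Om g)ᵀ * M.dFpre g).det) (x : Fin R → ℝ) :
    M.Hpre Om g *ᵥ (M.dFpre g *ᵥ x) = x := by
  rw [Hpre, mulVec_mulVec, Matrix.mul_assoc, nonsing_inv_mul _ hQ, one_mulVec]

theorem deltaStar_dotProduct_regressor (g t i : ℕ) (ω : Ω) :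
    M.deltaStar Om g t ⬝ᵥ M.regressor Om i g ω = M.thetaStar Om g t +
      (M.F t - M.F (g - 1)) ⬝ᵥ (M.Hpre Om g *ᵥ M.dYpre i g ω) := by
  have h : M.Fstar Om g t ⬝ᵥ ((Om g)ᵀ *ᵥ M.dYpre i g ω) =
      (M.F t - M.F (g - 1)) ⬝ᵥ (M.Hpre Om g *ᵥ M.dYpre i g ω) := by
    rw [Fstar, Hpre, ← dotProduct_mulVec, mulVec_mulVec]
  rw [← h, dotProduct, Fin.sum_univ_succ]
  simp [deltaStar, regressor, dotProduct]

/-- Eliminating the loadings: if a unit is untreated before period `g`, its pre-treatment differences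
determine `λ_i` up to errors, and its untreated outcome change from `g - 1` to `t` is
`δ*(g,t)' Z_i(g) + v_i(g,t)`. -/
theorem deltaStar_dotProduct_regressor_add_v {g t i : ℕ} {ω : Ω}
    (hQ : IsUnit ((Om g)ᵀ * M.dFpre g).det) (h : ∀ s ∈ Finset.Ico 1 g, M.Untreated i s ω) :
    M.deltaStar Om g t ⬝ᵥ M.regressor Om i g ω + M.v Om i g t ω =
      (M.θ t + M.η i ω + M.lam i ω ⬝ᵥ M.F t + M.e i t ω) -
      (M.θ (g - 1) + M.η i ω + M.lam i ω ⬝ᵥ M.F (g - 1) + M.e i (g - 1) ω) := by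
  rw [deltaStar_dotProduct_regressor, dYpre_eq h, mulVec_add, mulVec_add,
    Hpre_mulVec_dFpre_mulVec hQ, thetaStar, v, dotProduct_add, dotProduct_add,
    dotProduct_comm _ (M.lam i ω), dotProduct_sub (M.lam i ω)]
  ring

/-- `Y_it - Y_{i,g-1} - δ*(g,t)' Z_i(g)`, the observed outcome change net of its prediction from the
pre-treatment differences. -/
def resid (M : PanelModel Ω T R) (Om : (g : ℕ) → Matrix (Finset.Ico 2 g) (Fin R) ℝ)
    (i g t : ℕ) (ω : Ω) : ℝ :=
  M.Y i t ω - M.Y i (g - 1) ω - M.deltaStar Om g t ⬝ᵥ M.regressor Om i g ω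

theorem sigmaHet_le_sigmaHetGroup : M.sigmaHet ≤ M.sigmaHetGroup := by
  rw [sigmaHet, sigmaHetGroup]
  have h : (fun ω => (M.η 0 ω, M.lam 0 ω)) =
      (fun x : ℝ × (Fin R → ℝ) × ℕ∞ => (x.1, x.2.1)) ∘
        fun ω => (M.η 0 ω, M.lam 0 ω, M.group 0 ω) := rfl
  rw [h, ← MeasurableSpace.comap_comp]
  exact MeasurableSpace.comap_mono (by
    rw [← measurable_iff_comap_le]; fun_prop)

theorem stronglyMeasurable_factorPart (s : ℕ) : StronglyMeasurable[M.sigmaHet]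
    fun ω => M.θ s + M.η 0 ω + M.lam 0 ω ⬝ᵥ M.F s := by
  refine Measurable.stronglyMeasurable ?_
  have h : Measurable fun x : ℝ × (Fin R → ℝ) => M.θ s + x.1 + x.2 ⬝ᵥ M.F s := by
    simp only [dotProduct]; fun_prop
  exact h.comp (comap_measurable (fun ω => (M.η 0 ω, M.lam 0 ω)))

end Outcomes

variable {Ω : Type*} [MeasurableSpace Ω] {T R : ℕ} {M : PanelModel Ω T R} {μ : Measure Ω}
  {Om : (g : ℕ) → Matrix (Finset.Ico 2 g) (Fin R) ℝ}
  {What : (g t n : ℕ) → Ω → Matrix (M.comp μ t) (M.comp μ t) ℝ}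
  {W : (g t : ℕ) → Matrix (M.comp μ t) (M.comp μ t) ℝ}

theorem bounds_of_mem_identified {k : ℕ × ℕ} (hk : k ∈ M.identified μ) :
    2 ≤ k.1 ∧ k.1 ≤ k.2 ∧ k.2 ≤ T ∧ 0 < M.p μ k.1 := by
  simp only [identified, groupsDagger, groups, Finset.mem_filter, Finset.mem_product,
    Finset.mem_Icc] at hk
  have hT : M.tmax μ ≤ T := by
    refine Finset.sup_le fun t ht => ?_
    exact (Finset.mem_Icc.1 (Finset.mem_filter.1 ht).1).2
  obtain ⟨⟨⟨h1, -, hp⟩, h2⟩, h3⟩ := hk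
  exact ⟨by omega, h3, h2.2.trans hT, hp⟩

theorem lt_of_mem_comp {t : ℕ} (a : M.comp μ t) : (t : ℕ∞) < a :=
  (Finset.mem_filter.1 a.2).2

theorem ell_apply (i t : ℕ) (ω : Ω) (a : M.comp μ t) :
    M.ell μ i t ω a = (M.p μ a)⁻¹ * M.inGroup i a ω := by
  rw [ell, inGroup, div_eq_inv_mul]

theorem ae_untreated (hanti : M.NoAnticipation μ) (hife : M.InteractiveFixedEffects μ) (i : ℕ) :
    ∀ᵐ ω ∂μ, ∀ s ∈ Finset.Icc 1 T, (s : ℕ∞) < M.group i ω → M.Untreated i s ω := by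
  filter_upwards [hanti i, hife i] with ω h1 h2 s hs hlt
  rw [Untreated, h1 s hs hlt, h2 s hs]

/-- On a group first treated after `t` the residual is the composite error `v_i(g,t)`. -/
theorem ae_inGroup_mul_resid (hanti : M.NoAnticipation μ) (hife : M.InteractiveFixedEffects μ)
    {g t : ℕ} (hg : 2 ≤ g) (hgt : g ≤ t) (htT : t ≤ T)
    (hQ : IsUnit ((Om g)ᵀ * M.dFpre g).det) {a : ℕ∞} (ha : (t : ℕ∞) < a) (i : ℕ) :
    ∀ᵐ ω ∂μ, M.inGroup i a ω * M.resid Om i g t ω = M.inGroup i a ω * M.v Om i g t ω := by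
  filter_upwards [ae_untreated hanti hife i] with ω h
  refine inGroup_mul_congr fun hG => ?_
  have hu : ∀ s ∈ Finset.Icc 1 t, M.Untreated i s ω := fun s hs => by
    obtain ⟨h1, h2⟩ := Finset.mem_Icc.1 hs
    refine h s (Finset.mem_Icc.2 ⟨h1, h2.trans htT⟩) ?_
    rw [hG]
    exact lt_of_le_of_lt (by exact_mod_cast h2) ha
  have e := deltaStar_dotProduct_regressor_add_v (t := t) hQ fun s hs =>
    hu s (Finset.mem_Icc.2 ⟨(Finset.mem_Ico.1 hs).1, (Finset.mem_Ico.1 hs).2.le.trans hgt⟩)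
  have e1 := hu t (Finset.mem_Icc.2 ⟨by omega, le_rfl⟩)
  have e2 := hu (g - 1) (Finset.mem_Icc.2 ⟨by omega, by omega⟩)
  rw [Untreated] at e1 e2
  rw [resid, e1, e2]
  linarith

/-- On group `g` the untreated outcome change, which is not observed, is
`δ*(g,t)' Z_i(g) + v_i(g,t)`. -/
theorem ae_inGroup_mul_Y0_sub (hanti : M.NoAnticipation μ) (hife : M.InteractiveFixedEffects μ)
    {g t : ℕ} (hg : 2 ≤ g) (hgt : g ≤ t) (htT : t ≤ T)
    (hQ : IsUnit ((Om g)ᵀ * M.dFpre g).det) (i : ℕ) :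
    ∀ᵐ ω ∂μ, M.inGroup i g ω * (M.Y0 i t ω - M.Y i (g - 1) ω) =
      M.inGroup i g ω * (M.deltaStar Om g t ⬝ᵥ M.regressor Om i g ω + M.v Om i g t ω) := by
  filter_upwards [ae_untreated hanti hife i, hife i] with ω h hY0
  refine inGroup_mul_congr fun hG => ?_
  have hu : ∀ s ∈ Finset.Ico 1 g, M.Untreated i s ω := fun s hs => by
    obtain ⟨h1, h2⟩ := Finset.mem_Ico.1 hs
    refine h s (Finset.mem_Icc.2 ⟨h1, by omega⟩) ?_
    rw [hG]
    exact_mod_cast h2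
  have e2 := hu (g - 1) (Finset.mem_Ico.2 ⟨by omega, by omega⟩)
  rw [Untreated] at e2
  rw [deltaStar_dotProduct_regressor_add_v hQ hu, e2,
    hY0 t (Finset.mem_Icc.2 ⟨by omega, htT⟩)]

/-! ### Errors have mean zero on each group -/

theorem measurableSet_group (hG : Measurable (M.group 0)) (a : ℕ∞) :
    MeasurableSet {ω | M.group 0 ω = a} := hG (measurableSet_singleton a)

theorem integral_inGroup_mul (hG : Measurable (M.group 0)) (a : ℕ∞) (f : Ω → ℝ) :
    ∫ ω, M.inGroup 0 a ω * f ω ∂μ = ∫ ω in {ω | M.group 0 ω = a}, f ω ∂μ := by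
  rw [inGroup_mul_eq_indicator, integral_indicator (measurableSet_group hG a)]

theorem integrable_inGroup_mul (hG : Measurable (M.group 0)) (a : ℕ∞) {f : Ω → ℝ}
    (hf : Integrable f μ) : Integrable (fun ω => M.inGroup 0 a ω * f ω) μ := by
  rw [inGroup_mul_eq_indicator]
  exact hf.indicator (measurableSet_group hG a)

theorem memLp_inGroup_mul (hG : Measurable (M.group 0)) (a : ℕ∞) {f : Ω → ℝ}
    (hf : MemLp f 2 μ) : MemLp (fun ω => M.inGroup 0 a ω * f ω) 2 μ := by
  rw [inGroup_mul_eq_indicator]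
  exact hf.indicator (measurableSet_group hG a)

theorem integrable_inGroup [IsFiniteMeasure μ] (hG : Measurable (M.group 0)) (a : ℕ∞) :
    Integrable (M.inGroup 0 a) μ := by
  simpa using integrable_inGroup_mul hG a (integrable_const (μ := μ) (1 : ℝ))

theorem integral_inGroup (hG : Measurable (M.group 0)) (a : ℕ∞) :
    ∫ ω, M.inGroup 0 a ω ∂μ = M.p μ a := by
  have := integral_inGroup_mul (μ := μ) hG a fun _ => 1
  simpa [p, measureReal_def] using this

theorem integrable_ell_mul (hG : Measurable (M.group 0)) {t : ℕ} (a : M.comp μ t) {f : Ω → ℝ}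
    (hf : Integrable f μ) : Integrable (fun ω => M.ell μ 0 t ω a * f ω) μ := by
  simp only [ell_apply, mul_assoc]
  exact (integrable_inGroup_mul hG a hf).const_mul _

/-- `f` is integrable and has mean zero on each group. -/
def GroupCentered (M : PanelModel Ω T R) (μ : Measure Ω) (f : Ω → ℝ) : Prop :=
  Integrable f μ ∧ ∀ a, ∫ ω, M.inGroup 0 a ω * f ω ∂μ = 0

namespace GroupCentered

theorem sub (hG : Measurable (M.group 0)) {f h : Ω → ℝ} (hf : M.GroupCentered μ f)
    (hh : M.GroupCentered μ h) : M.GroupCentered μ fun ω => f ω - h ω := by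
  refine ⟨hf.1.sub hh.1, fun a => ?_⟩
  simp only [mul_sub]
  rw [integral_sub (integrable_inGroup_mul hG a hf.1) (integrable_inGroup_mul hG a hh.1),
    hf.2, hh.2, sub_zero]

theorem dotProduct (hG : Measurable (M.group 0)) {ι : Type*} [Fintype ι] (c : ι → ℝ)
    {f : Ω → ι → ℝ} (hf : ∀ k, M.GroupCentered μ fun ω => f ω k) :
    M.GroupCentered μ fun ω => c ⬝ᵥ f ω := by
  refine ⟨integrable_finsetSum _ fun k _ => (hf k).1.const_mul _, fun a => ?_⟩
  simp only [_root_.dotProduct, Finset.mul_sum, mul_left_comm _ (c _)]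
  rw [integral_finsetSum _ fun k _ => (integrable_inGroup_mul hG a (hf k).1).const_mul _]
  exact Finset.sum_eq_zero fun k _ => by rw [integral_const_mul, (hf k).2, mul_zero]

end GroupCentered

theorem sigmaHetGroup_le (hreg : M.Regular μ) :
    M.sigmaHetGroup ≤ ‹MeasurableSpace Ω› := by
  rw [sigmaHetGroup, ← measurable_iff_comap_le]
  exact hreg.measurable_eta.prodMk (hreg.measurable_lam.prodMk hreg.measurable_group)

theorem ae_Y0_eq (hife : M.InteractiveFixedEffects μ) {s : ℕ} (hs : s ∈ Finset.Icc 1 T) :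
    M.Y0 0 s =ᵐ[μ] (fun ω => M.θ s + M.η 0 ω + M.lam 0 ω ⬝ᵥ M.F s) + M.e 0 s := by
  filter_upwards [hife 0] with ω h
  simpa using h s hs

theorem integrable_factorPart (hreg : M.Regular μ) (hife : M.InteractiveFixedEffects μ)
    {s : ℕ} (hs : s ∈ Finset.Icc 1 T) :
    Integrable (fun ω => M.θ s + M.η 0 ω + M.lam 0 ω ⬝ᵥ M.F s) μ := by
  refine ((hreg.integrable_Y0 s hs).sub (hreg.integrable_e s hs)).congr ?_
  filter_upwards [ae_Y0_eq hife hs] with ω h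
  simp [h]

section Errors

variable [IsProbabilityMeasure μ]

/-- Unconfoundedness carries `E[e_t | η, λ] = 0` over to `E[e_t | η, λ, G] = 0`, because
`Y_t(0) - e_t` is a function of `(η, λ)`. -/
theorem groupCentered_e (hreg : M.Regular μ) (hife : M.InteractiveFixedEffects μ)
    (herr : M.ErrorsMeanZero μ) (hunc : M.Unconfounded μ) {s : ℕ} (hs : s ∈ Finset.Icc 1 T) :
    M.GroupCentered μ (M.e 0 s) := by
  have he := hreg.integrable_e s hs
  have hf := integrable_factorPart hreg hife hs
  have hY := ae_Y0_eq hife hs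
  have hle' := sigmaHetGroup_le hreg
  have hle := (sigmaHet_le_sigmaHetGroup (M := M)).trans hle'
  have hsm := stronglyMeasurable_factorPart (M := M) s
  set f : Ω → ℝ := fun ω => M.θ s + M.η 0 ω + M.lam 0 ω ⬝ᵥ M.F s with hfdef
  -- `f` is the part of `Y_s(0)` that is a function of `(η, λ)`
  have h1 : μ[M.Y0 0 s | M.sigmaHet] =ᵐ[μ] f := by
    filter_upwards [(condExp_congr_ae hY).trans (condExp_add hf he M.sigmaHet), herr s hs]
      with ω h h'
    rw [h, Pi.add_apply, condExp_of_stronglyMeasurable hle hsm hf, h']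
    simp
  have h2 : μ[M.e 0 s | M.sigmaHetGroup] =ᵐ[μ] 0 := by
    filter_upwards [(condExp_congr_ae hY).trans (condExp_add hf he M.sigmaHetGroup), hunc s hs, h1]
      with ω h h' h''
    rw [h', h'', Pi.add_apply,
      condExp_of_stronglyMeasurable hle' (hsm.mono sigmaHet_le_sigmaHetGroup) hf] at h
    simpa using h
  refine ⟨he, fun a => ?_⟩
  have hset : MeasurableSet[M.sigmaHetGroup] {ω | M.group 0 ω = a} :=
    ⟨{x | x.2.2 = a}, measurable_snd.snd (measurableSet_singleton a), rfl⟩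
  rw [integral_inGroup_mul hreg.measurable_group, ← setIntegral_condExp hle' he hset,
    integral_congr_ae (ae_restrict_of_ae h2)]
  simp

theorem groupCentered_dEpre (hreg : M.Regular μ) (hife : M.InteractiveFixedEffects μ)
    (herr : M.ErrorsMeanZero μ) (hunc : M.Unconfounded μ) {g : ℕ} (hgT : g ≤ T)
    (s : Finset.Ico 2 g) : M.GroupCentered μ fun ω => M.dEpre 0 g ω s := by
  obtain ⟨h1, h2⟩ := Finset.mem_Ico.1 s.2
  exact (groupCentered_e hreg hife herr hunc (Finset.mem_Icc.2 ⟨by omega, by omega⟩)).sub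
    hreg.measurable_group
    (groupCentered_e hreg hife herr hunc (Finset.mem_Icc.2 ⟨by omega, by omega⟩))

theorem groupCentered_v (hreg : M.Regular μ) (hife : M.InteractiveFixedEffects μ)
    (herr : M.ErrorsMeanZero μ) (hunc : M.Unconfounded μ) {g t : ℕ} (hg : 2 ≤ g) (hgt : g ≤ t)
    (htT : t ≤ T) : M.GroupCentered μ (M.v Om 0 g t) := by
  have hG := hreg.measurable_group
  have he : ∀ s ∈ Finset.Icc 1 T, M.GroupCentered μ (M.e 0 s) := fun s hs =>
    groupCentered_e hreg hife herr hunc hs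
  have h := ((he t (Finset.mem_Icc.2 ⟨by omega, htT⟩)).sub hG
    (he (g - 1) (Finset.mem_Icc.2 ⟨by omega, by omega⟩))).sub hG
    (GroupCentered.dotProduct hG ((M.F t - M.F (g - 1)) ᵥ* M.Hpre Om g)
      (groupCentered_dEpre hreg hife herr hunc (hgt.trans htT)))
  simp only [← dotProduct_mulVec] at h
  exact h

end Errors

/-! ### Statistics of the observed data -/

theorem isUnitStatistic_Y {t : ℕ} (ht : t ∈ Finset.Icc 1 T) :
    IsUnitStatistic μ M.obs fun i ω => M.Y i t ω :=
  .of_comp (φ := fun x : (Finset.Icc 1 T → ℝ) × ℕ∞ => x.1 ⟨t, ht⟩) (by fun_prop)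

theorem isUnitStatistic_inGroup (a : ℕ∞) :
    IsUnitStatistic μ M.obs fun i ω => M.inGroup i a ω :=
  .of_comp (φ := fun x : (Finset.Icc 1 T → ℝ) × ℕ∞ => if x.2 = a then (1 : ℝ) else 0)
    (Measurable.ite (measurable_snd (measurableSet_singleton a)) measurable_const measurable_const)

theorem isUnitStatistic_regressor {g : ℕ} (hgT : g ≤ T) (j : Fin (R + 1)) :
    IsUnitStatistic μ M.obs fun i ω => M.regressor Om i g ω j := by
  refine Fin.cases ?_ (fun r => ?_) j
  · exact .const 1
  · refine IsUnitStatistic.dotProduct ((Om g)ᵀ r) fun s => ?_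
    obtain ⟨h1, h2⟩ := Finset.mem_Ico.1 s.2
    exact (isUnitStatistic_Y (Finset.mem_Icc.2 ⟨by omega, by omega⟩)).sub
      (isUnitStatistic_Y (Finset.mem_Icc.2 ⟨by omega, by omega⟩))

theorem isUnitStatistic_resid {g t : ℕ} (hg : 2 ≤ g) (hgt : g ≤ t) (htT : t ≤ T) :
    IsUnitStatistic μ M.obs fun i ω => M.resid Om i g t ω :=
  ((isUnitStatistic_Y (Finset.mem_Icc.2 ⟨by omega, htT⟩)).sub
    (isUnitStatistic_Y (Finset.mem_Icc.2 ⟨by omega, by omega⟩))).sub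
    (IsUnitStatistic.dotProduct _ (isUnitStatistic_regressor (hgt.trans htT)))

section Moments

variable [IsProbabilityMeasure μ]

theorem memLp_Y (hiid : M.IIDSampling μ) (hmom : M.FourthMoment μ) {t : ℕ}
    (ht : t ∈ Finset.Icc 1 T) : MemLp (M.Y 0 t) 2 μ := by
  have hm : AEMeasurable (M.Y 0 t) μ := (isUnitStatistic_Y ht).aemeasurable hiid.2 0
  rw [memLp_two_iff_integrable_sq hm.aestronglyMeasurable]
  refine (hmom.add (integrable_const 1)).mono' (hm.pow_const 2).aestronglyMeasurable
    (ae_of_all _ fun ω => ?_)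
  have h1 : M.Y 0 t ω ^ 2 ≤ ∑ s ∈ Finset.Icc 1 T, M.Y 0 s ω ^ 2 :=
    Finset.single_le_sum (f := fun s => M.Y 0 s ω ^ 2) (fun s _ => sq_nonneg _) ht
  -- `x ≤ x² + 1` bounds the second moment by the fourth
  rw [Real.norm_eq_abs, abs_of_nonneg (sq_nonneg _), Pi.add_apply]
  nlinarith [sq_nonneg (∑ s ∈ Finset.Icc 1 T, M.Y 0 s ω ^ 2 - 1)]

theorem memLp_regressor (hiid : M.IIDSampling μ) (hmom : M.FourthMoment μ) {g : ℕ} (hgT : g ≤ T)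
    (j : Fin (R + 1)) : MemLp (fun ω => M.regressor Om 0 g ω j) 2 μ := by
  refine Fin.cases ?_ (fun r => ?_) j
  · exact memLp_const 1
  · refine memLp_dotProduct ((Om g)ᵀ r) fun s => ?_
    obtain ⟨h1, h2⟩ := Finset.mem_Ico.1 s.2
    exact (memLp_Y hiid hmom (Finset.mem_Icc.2 ⟨by omega, by omega⟩)).sub
      (memLp_Y hiid hmom (Finset.mem_Icc.2 ⟨by omega, by omega⟩))

theorem memLp_resid (hiid : M.IIDSampling μ) (hmom : M.FourthMoment μ) {g t : ℕ} (hg : 2 ≤ g)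
    (hgt : g ≤ t) (htT : t ≤ T) : MemLp (M.resid Om 0 g t) 2 μ :=
  ((memLp_Y hiid hmom (Finset.mem_Icc.2 ⟨by omega, htT⟩)).sub
    (memLp_Y hiid hmom (Finset.mem_Icc.2 ⟨by omega, by omega⟩))).sub
    (memLp_dotProduct _ (memLp_regressor hiid hmom (hgt.trans htT)))

/-! ### Identification -/

/-- Integrability of the loadings is not assumed: since `𝛀' ΔF^pre(g)` is invertible, they are linear
combinations of differences of the integrable variables `η + λ' F_s`. -/
theorem integrable_lam (hreg : M.Regular μ) (hife : M.InteractiveFixedEffects μ) {g : ℕ}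
    (hgT : g ≤ T) (hQ : IsUnit ((Om g)ᵀ * M.dFpre g).det) (r : Fin R) :
    Integrable (fun ω => M.lam 0 ω r) μ := by
  have h : ∀ s : Finset.Ico 2 g, Integrable (fun ω => (M.dFpre g *ᵥ M.lam 0 ω) s) μ := by
    intro s
    obtain ⟨h1, h2⟩ := Finset.mem_Ico.1 s.2
    have h := (integrable_factorPart hreg hife (s := s) (Finset.mem_Icc.2 ⟨by omega, by omega⟩)).sub
      (integrable_factorPart hreg hife (s := s - 1) (Finset.mem_Icc.2 ⟨by omega, by omega⟩))
    refine (h.sub (integrable_const (M.θ s - M.θ (s - 1)))).congr (ae_of_all _ fun ω => ?_)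
    have e3 : (M.dFpre g *ᵥ M.lam 0 ω) s =
        M.lam 0 ω ⬝ᵥ M.F s - M.lam 0 ω ⬝ᵥ M.F (s - 1) := by
      rw [← dotProduct_sub, dotProduct_comm]
      rfl
    simp only [Pi.sub_apply, e3]
    ring
  have h2 : Integrable (fun ω => (M.Hpre Om g *ᵥ (M.dFpre g *ᵥ M.lam 0 ω)) r) μ :=
    integrable_finsetSum Finset.univ fun s _ => (h s).const_mul (M.Hpre Om g r s)
  simpa only [Hpre_mulVec_dFpre_mulVec hQ] using h2

/-- `Γ(g,t) = Λ^comp(g,t) C` for the matrix `C` of the affine map taking `(1, λ)` to the error-free part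
of the regressor; the matrix is given by its action `x ↦ C x`. -/
theorem Gam_mulVec (hreg : M.Regular μ) (hanti : M.NoAnticipation μ) (hiid : M.IIDSampling μ)
    (hife : M.InteractiveFixedEffects μ) (herr : M.ErrorsMeanZero μ) (hunc : M.Unconfounded μ)
    (hmom : M.FourthMoment μ) {g t : ℕ} (hgt : g ≤ t) (htT : t ≤ T)
    (hQ : IsUnit ((Om g)ᵀ * M.dFpre g).det) (x : Fin (R + 1) → ℝ) :
    M.Gam μ Om g t *ᵥ x = M.LambdaComp μ t *ᵥ
      (Fin.cons (x 0 + Fin.tail x ⬝ᵥ ((Om g)ᵀ *ᵥ M.dThetaPre g))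
        (Fin.tail x ᵥ* ((Om g)ᵀ * M.dFpre g)) : Fin (R + 1) → ℝ) := by
  have hG := hreg.measurable_group
  have hgT := hgt.trans htT
  set y : Fin (R + 1) → ℝ := Fin.cons (x 0 + Fin.tail x ⬝ᵥ ((Om g)ᵀ *ᵥ M.dThetaPre g))
    (Fin.tail x ᵥ* ((Om g)ᵀ * M.dFpre g)) with hy
  ext a
  have hlam : ∀ j : Fin (R + 1),
      Integrable (fun ω => (Fin.cons 1 (M.lam 0 ω) : Fin (R + 1) → ℝ) j) μ := fun j => by
    refine Fin.cases ?_ (fun r => ?_) j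
    · simp
    · simpa using integrable_lam hreg hife hgT hQ r
  have hdE : M.GroupCentered μ fun ω => (Fin.tail x ᵥ* (Om g)ᵀ) ⬝ᵥ M.dEpre 0 g ω :=
    GroupCentered.dotProduct hG _ (groupCentered_dEpre hreg hife herr hunc hgT)
  -- comparison groups are untreated until `t`, so the regressor is affine in the loadings there
  have hpt : ∀ᵐ ω ∂μ, M.ell μ 0 t ω a * (M.regressor Om 0 g ω ⬝ᵥ x) =
      M.ell μ 0 t ω a * ((Fin.cons 1 (M.lam 0 ω) : Fin (R + 1) → ℝ) ⬝ᵥ y) +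
        M.ell μ 0 t ω a * ((Fin.tail x ᵥ* (Om g)ᵀ) ⬝ᵥ M.dEpre 0 g ω) := by
    filter_upwards [ae_untreated hanti hife 0] with ω h
    rw [← mul_add]
    simp only [ell_apply, mul_assoc]
    congr 1
    refine inGroup_mul_congr fun hGa => ?_
    have hu : ∀ s ∈ Finset.Ico 1 g, M.Untreated 0 s ω := fun s hs => by
      obtain ⟨h1, h2⟩ := Finset.mem_Ico.1 hs
      refine h s (Finset.mem_Icc.2 ⟨h1, by omega⟩) ?_
      rw [hGa]
      exact lt_of_le_of_lt (by exact_mod_cast (by omega : s ≤ t)) (lt_of_mem_comp a)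
    have e1 : M.regressor Om 0 g ω ⬝ᵥ x =
        x 0 + Fin.tail x ⬝ᵥ ((Om g)ᵀ *ᵥ M.dYpre 0 g ω) := by
      rw [dotProduct, Fin.sum_univ_succ, dotProduct_comm (Fin.tail x)]
      simp [regressor, dotProduct, Fin.tail]
    have e2 : (Fin.cons 1 (M.lam 0 ω) : Fin (R + 1) → ℝ) ⬝ᵥ y =
        x 0 + Fin.tail x ⬝ᵥ ((Om g)ᵀ *ᵥ M.dThetaPre g) +
          (Fin.tail x ᵥ* ((Om g)ᵀ * M.dFpre g)) ⬝ᵥ M.lam 0 ω := by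
      rw [dotProduct, Fin.sum_univ_succ, dotProduct_comm _ (M.lam 0 ω), hy]
      simp only [Fin.cons_zero, Fin.cons_succ, one_mul]
      rfl
    rw [e1, e2, dYpre_eq hu, mulVec_add, mulVec_add, dotProduct_add, dotProduct_add,
      ← dotProduct_mulVec, ← dotProduct_mulVec, mulVec_mulVec]
    ring
  have hreg2 : ∀ j, Integrable (fun ω => M.ell μ 0 t ω a * M.regressor Om 0 g ω j) μ := fun j =>
    integrable_ell_mul hG a ((memLp_regressor hiid hmom hgT j).integrable one_le_two)
  have hlam2 : ∀ j, Integrable (fun ω => M.ell μ 0 t ω a *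
      (Fin.cons 1 (M.lam 0 ω) : Fin (R + 1) → ℝ) j) μ := fun j => integrable_ell_mul hG a (hlam j)
  have hdE0 : ∫ ω, M.ell μ 0 t ω a * ((Fin.tail x ᵥ* (Om g)ᵀ) ⬝ᵥ M.dEpre 0 g ω) ∂μ = 0 := by
    simp only [ell_apply, mul_assoc]
    rw [integral_const_mul, hdE.2, mul_zero]
  calc (M.Gam μ Om g t *ᵥ x) a
      = ∫ ω, M.ell μ 0 t ω a * (M.regressor Om 0 g ω ⬝ᵥ x) ∂μ :=
        (integral_mul_dotProduct x hreg2).symm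
    _ = ∫ ω, M.ell μ 0 t ω a * ((Fin.cons 1 (M.lam 0 ω) : Fin (R + 1) → ℝ) ⬝ᵥ y) ∂μ := by
        rw [integral_congr_ae hpt, integral_add _ (integrable_ell_mul hG a hdE.1), hdE0, add_zero]
        exact integrable_ell_mul hG a (integrable_finsetSum _ fun j _ => (hlam j).mul_const _)
    _ = _ := integral_mul_dotProduct y hlam2

/-- `Γ(g,t)` has full column rank, the regressor being an invertible affine image of the loadings up
to errors of mean zero on each group. -/
theorem Gam_mulVec_injective (hreg : M.Regular μ) (hanti : M.NoAnticipation μ)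
    (hiid : M.IIDSampling μ) (hife : M.InteractiveFixedEffects μ) (herr : M.ErrorsMeanZero μ)
    (hunc : M.Unconfounded μ) (hmom : M.FourthMoment μ) {g t : ℕ} (hgt : g ≤ t) (htT : t ≤ T)
    (hQ : IsUnit ((Om g)ᵀ * M.dFpre g).det) (hL : (M.LambdaComp μ t).rank = R + 1) :
    Function.Injective (M.Gam μ Om g t).mulVec := by
  refine (injective_iff_map_eq_zero (M.Gam μ Om g t).mulVecLin).2 fun x hx => ?_
  rw [mulVecLin_apply, Gam_mulVec hreg hanti hiid hife herr hunc hmom hgt htT hQ] at hx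
  have hy := mulVec_injective_of_rank_eq hL (hx.trans (mulVec_zero _).symm)
  have htail : Fin.tail x = 0 := by
    have h1 : Fin.tail x ᵥ* ((Om g)ᵀ * M.dFpre g) = 0 := by
      ext r
      simpa using congrFun hy r.succ
    exact vecMul_injective_of_isUnit ((isUnit_iff_isUnit_det _).2 hQ)
      (h1.trans (zero_vecMul _).symm)
  have h0 : x 0 = 0 := by simpa [htail] using congrFun hy 0
  ext j
  refine Fin.cases h0 (fun r => ?_) j
  exact congrFun htail r

/-- Identification: `p_g ATT(g,t) = E[1{G = g}(Y_t - Y_{g-1})] - δ*(g,t)' E[A(g)]`. -/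
theorem p_mul_ATT (hreg : M.Regular μ) (hanti : M.NoAnticipation μ) (hiid : M.IIDSampling μ)
    (hife : M.InteractiveFixedEffects μ) (herr : M.ErrorsMeanZero μ) (hunc : M.Unconfounded μ)
    (hmom : M.FourthMoment μ) {g t : ℕ} (hg : 2 ≤ g) (hgt : g ≤ t) (htT : t ≤ T)
    (hp : 0 < M.p μ g) (hQ : IsUnit ((Om g)ᵀ * M.dFpre g).det) :
    M.p μ g * M.ATT μ g t = ∫ ω, M.X 0 g t ω ∂μ - M.deltaStar Om g t ⬝ᵥ M.meanA μ Om g := by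
  have hG := hreg.measurable_group
  have ht : t ∈ Finset.Icc 1 T := Finset.mem_Icc.2 ⟨by omega, htT⟩
  have hg1 : g - 1 ∈ Finset.Icc 1 T := Finset.mem_Icc.2 ⟨by omega, by omega⟩
  have hYt := (memLp_Y hiid hmom ht).integrable one_le_two
  have hYg := (memLp_Y hiid hmom hg1).integrable one_le_two
  have hY0 := hreg.integrable_Y0 t ht
  have hv := groupCentered_v (Om := Om) hreg hife herr hunc hg hgt htT
  have hregr : ∀ j, Integrable (fun ω => M.inGroup 0 g ω * M.regressor Om 0 g ω j) μ := fun j =>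
    integrable_inGroup_mul hG g
      ((memLp_regressor hiid hmom (hgt.trans htT) j).integrable one_le_two)
  -- on group `g` the observed outcome is `Y_t(g)`
  have e1 : M.p μ g * M.ATT μ g t = ∫ ω, M.inGroup 0 g ω * (M.Y 0 t ω - M.Y0 0 t ω) ∂μ := by
    rw [ATT, ProbabilityTheory.cond, integral_smul_measure, integral_inGroup_mul hG, smul_eq_mul,
      ENNReal.toReal_inv, p, measureReal_def, ← mul_assoc, mul_inv_cancel₀ (by
        rw [← measureReal_def]; exact hp.ne'), one_mul]
    refine setIntegral_congr_fun (measurableSet_group hG g) fun ω hω => ?_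
    have hω' : M.group 0 ω = g := hω
    simp only [Y, hω']
  -- split the outcome change at the untreated outcome `Y_t(0)`
  have e2 : ∫ ω, M.X 0 g t ω ∂μ = ∫ ω, M.inGroup 0 g ω * (M.Y 0 t ω - M.Y0 0 t ω) ∂μ +
      ∫ ω, M.inGroup 0 g ω * (M.Y0 0 t ω - M.Y 0 (g - 1) ω) ∂μ := by
    have hi1 : Integrable (fun ω => M.inGroup 0 g ω * (M.Y 0 t ω - M.Y0 0 t ω)) μ :=
      integrable_inGroup_mul hG g (hYt.sub hY0)
    have hi2 : Integrable (fun ω => M.inGroup 0 g ω * (M.Y0 0 t ω - M.Y 0 (g - 1) ω)) μ :=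
      integrable_inGroup_mul hG g (hY0.sub hYg)
    rw [← integral_add hi1 hi2]
    refine integral_congr_ae (ae_of_all _ fun ω => ?_)
    simp only [X, inGroup]
    ring
  have e3 : ∫ ω, M.inGroup 0 g ω * (M.Y0 0 t ω - M.Y 0 (g - 1) ω) ∂μ =
      M.deltaStar Om g t ⬝ᵥ M.meanA μ Om g := by
    rw [integral_congr_ae (ae_inGroup_mul_Y0_sub hanti hife hg hgt htT hQ 0)]
    simp only [mul_add, dotProduct_comm (M.deltaStar Om g t)]
    rw [integral_add _ (integrable_inGroup_mul hG g hv.1), hv.2, add_zero,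
      integral_mul_dotProduct _ hregr]
    · rfl
    · simp only [dotProduct, Finset.mul_sum, ← mul_assoc]
      exact integrable_finsetSum _ fun j _ => (hregr j).mul_const _
  rw [e1, e2, e3]
  ring

end Moments

/-! ### Exact expansion of the estimator -/

/-- `1{G_i = g}(Y_it - Y_{i,g-1} - δ*(g,t)' Z_i(g) - ATT(g,t))`, the contribution of unit `i` to the
sampling error of `ATT(g,t)` when `δ*(g,t)` is known. -/
def attScore (M : PanelModel Ω T R) (μ : Measure Ω)
    (Om : (g : ℕ) → Matrix (Finset.Ico 2 g) (Fin R) ℝ) (i g t : ℕ) (ω : Ω) : ℝ :=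
  M.inGroup i g ω * (M.resid Om i g t ω - M.ATT μ g t)

/-- `ℓ_i^comp(g,t)(Y_it - Y_{i,g-1} - δ*(g,t)' Z_i(g))`, the moment function whose mean vanishes at
`δ*(g,t)`. -/
def compScore (M : PanelModel Ω T R) (μ : Measure Ω)
    (Om : (g : ℕ) → Matrix (Finset.Ico 2 g) (Fin R) ℝ) (i g t : ℕ) (ω : Ω) : M.comp μ t → ℝ :=
  fun a => M.ell μ i t ω a * M.resid Om i g t ω

/-- `E[A(g)]' B(g,t)`, the weights of the comparison groups in the influence function. -/
def compWeight (M : PanelModel Ω T R) (μ : Measure Ω)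
    (Om : (g : ℕ) → Matrix (Finset.Ico 2 g) (Fin R) ℝ)
    (W : (g t : ℕ) → Matrix (M.comp μ t) (M.comp μ t) ℝ) (g t : ℕ) : M.comp μ t → ℝ :=
  M.meanA μ Om g ᵥ* gmmMatrix (M.Gam μ Om g t) (W g t)

/-- `𝔼_n[A_i(g)]`. -/
def AHat (M : PanelModel Ω T R) (Om : (g : ℕ) → Matrix (Finset.Ico 2 g) (Fin R) ℝ)
    (g n : ℕ) (ω : Ω) : Fin (R + 1) → ℝ :=
  fun j => sampleMean n (fun i ω => M.A Om i g ω j) ω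

/-- The sample analogue `𝔼_n[A_i(g)]' (Γ̂' Ŵ Γ̂)⁻¹ Γ̂' Ŵ` of `compWeight`. -/
def compWeightHat (M : PanelModel Ω T R) (μ : Measure Ω)
    (Om : (g : ℕ) → Matrix (Finset.Ico 2 g) (Fin R) ℝ)
    (What : (g t n : ℕ) → Ω → Matrix (M.comp μ t) (M.comp μ t) ℝ)
    (g t n : ℕ) (ω : Ω) : M.comp μ t → ℝ :=
  M.AHat Om g n ω ᵥ* gmmMatrix (M.GamHat μ Om g t n ω) (What g t n ω)

theorem attScore_eq (i g t : ℕ) (ω : Ω) :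
    M.attScore μ Om i g t ω = M.X i g t ω - M.deltaStar Om g t ⬝ᵥ M.A Om i g ω -
      M.ATT μ g t * M.inGroup i g ω := by
  have : M.A Om i g ω = M.inGroup i g ω • M.regressor Om i g ω := rfl
  rw [this, dotProduct_smul, attScore, resid, X]
  change _ = M.inGroup i g ω * _ - _ - _
  rw [smul_eq_mul]
  ring

/-- The exact sampling error of the estimator where the inverses in it exist:
`p̂_g⁻¹ { 𝔼_n[attScore] - 𝔼_n[A]' B̂ 𝔼_n[compScore] }`. -/
theorem ATTHat_sub_ATT {g t n : ℕ} {ω : Ω}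
    (hdet : IsUnit ((M.GamHat μ Om g t n ω)ᵀ * What g t n ω * M.GamHat μ Om g t n ω).det)
    (hp : M.pHat g n ω ≠ 0) :
    M.ATTHat μ Om What g t n ω - M.ATT μ g t =
      (M.pHat g n ω)⁻¹ * (sampleMean n (fun i ω => M.attScore μ Om i g t ω) ω -
        M.compWeightHat μ Om What g t n ω ⬝ᵥ
          fun a => sampleMean n (fun i ω => M.compScore μ Om i g t ω a) ω) := by
  have hm : M.momentHat μ g t n ω = M.GamHat μ Om g t n ω *ᵥ M.deltaStar Om g t +
      fun a => sampleMean n (fun i ω => M.compScore μ Om i g t ω a) ω := by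
    ext a
    have h1 : (M.GamHat μ Om g t n ω *ᵥ M.deltaStar Om g t) a = sampleMean n (fun i ω =>
        M.deltaStar Om g t ⬝ᵥ fun j => M.ell μ i t ω a * M.regressor Om i g ω j) ω := by
      rw [sampleMean_dotProduct, dotProduct_comm]
      rfl
    rw [Pi.add_apply, h1, ← sub_eq_iff_eq_add', momentHat, ← sampleMean_sub]
    congr 1
    ext i ω
    rw [compScore, resid]
    have : (fun j => M.ell μ i t ω a * M.regressor Om i g ω j) =
      M.ell μ i t ω a • M.regressor Om i g ω := rfl
    rw [this, dotProduct_smul, smul_eq_mul]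
    ring
  -- `B̂ Γ̂ = 1`, so `δ̂*` misses `δ*` by `B̂` times the sample moments at `δ*`
  have hd : M.deltaHat μ Om What g t n ω = M.deltaStar Om g t +
      gmmMatrix (M.GamHat μ Om g t n ω) (What g t n ω) *ᵥ
        fun a => sampleMean n (fun i ω => M.compScore μ Om i g t ω a) ω := by
    change gmmMatrix (M.GamHat μ Om g t n ω) (What g t n ω) *ᵥ M.momentHat μ g t n ω = _
    rw [hm, mulVec_add, mulVec_mulVec, gmmMatrix_mul_self hdet, one_mulVec]
  have hs : sampleMean n (fun i ω => M.attScore μ Om i g t ω) ω =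
      sampleMean n (fun i ω => M.X i g t ω) ω - M.deltaStar Om g t ⬝ᵥ M.AHat Om g n ω -
        M.ATT μ g t * M.pHat g n ω := by
    simp only [attScore_eq, sampleMean_sub, sampleMean_dotProduct, sampleMean_const_mul]
    rfl
  rw [hs, compWeightHat, ← dotProduct_mulVec]
  change (M.pHat g n ω)⁻¹ * (_ - M.AHat Om g n ω ⬝ᵥ _) - _ = _
  rw [hd, dotProduct_add, dotProduct_comm (M.deltaStar Om g t)]
  field_simp
  ring

/-! ### The influence function of an identified pair -/

/-- What an identified pair `(g,t)` provides: the order of the periods, a positive group probability,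
and invertibility of `𝛀' ΔF^pre(g)` and of `Γ' W Γ`. -/
structure PairRegularity (M : PanelModel Ω T R) (μ : Measure Ω)
    (Om : (g : ℕ) → Matrix (Finset.Ico 2 g) (Fin R) ℝ)
    (W : (g t : ℕ) → Matrix (M.comp μ t) (M.comp μ t) ℝ) (g t : ℕ) : Prop where
  two_le : 2 ≤ g
  le : g ≤ t
  le_T : t ≤ T
  p_pos : 0 < M.p μ g
  det_factor : IsUnit ((Om g)ᵀ * M.dFpre g).det
  det_moment : IsUnit ((M.Gam μ Om g t)ᵀ * W g t * M.Gam μ Om g t).det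

theorem isUnitStatistic_attScore (h : M.PairRegularity μ Om W g t) :
    IsUnitStatistic μ M.obs fun i ω => M.attScore μ Om i g t ω :=
  (isUnitStatistic_inGroup _).mul ((isUnitStatistic_resid h.two_le h.le h.le_T).sub (.const _))

theorem isUnitStatistic_compScore (h : M.PairRegularity μ Om W g t) (a : M.comp μ t) :
    IsUnitStatistic μ M.obs fun i ω => M.compScore μ Om i g t ω a := by
  simp only [compScore, ell_apply]
  exact ((IsUnitStatistic.const _).mul (isUnitStatistic_inGroup _)).mul
    (isUnitStatistic_resid h.two_le h.le h.le_T)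

/-- `Ŵ(g,t)` converges to `W(g,t)` in probability. -/
def WeightTendsto (What : (g t n : ℕ) → Ω → Matrix (M.comp μ t) (M.comp μ t) ℝ)
    (W : (g t : ℕ) → Matrix (M.comp μ t) (M.comp μ t) ℝ) (g t : ℕ) : Prop :=
  Tendsto (fun x : ℕ × Ω => What g t x.1 x.2) (inProb μ) (𝓝 (W g t))

theorem weightTendsto (hW : M.WeightingConsistent μ What W) {k : ℕ × ℕ}
    (hk : k ∈ M.identified μ) : WeightTendsto What W k.1 k.2 :=
  tendsto_pi_nhds.2 fun a => tendsto_pi_nhds.2 fun b =>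
    (tendstoInMeasure_const_iff (f := fun n ω => What k.1 k.2 n ω a b)).1 ((hW k hk).2 a b).2

theorem aemeasurable_ATTHat (hiid : M.IIDSampling μ) {g t : ℕ}
    (h : M.PairRegularity μ Om W g t)
    (hw : ∀ n a b, AEMeasurable (fun ω => What g t n ω a b) μ) (n : ℕ) :
    AEMeasurable (fun ω => M.ATTHat μ Om What g t n ω) μ := by
  have hI : ∀ a i, AEMeasurable (M.inGroup i a) μ := fun a i =>
    (isUnitStatistic_inGroup a).aemeasurable hiid.2 i
  have hYt : ∀ i, AEMeasurable (fun ω => M.Y i t ω - M.Y i (g - 1) ω) μ := fun i =>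
    ((isUnitStatistic_Y (Finset.mem_Icc.2 ⟨by have := h.two_le; have := h.le; omega,
      h.le_T⟩)).sub (isUnitStatistic_Y (Finset.mem_Icc.2 ⟨by have := h.two_le; omega,
      by have := h.le; have := h.le_T; omega⟩))).aemeasurable hiid.2 i
  have hZ : ∀ i j, AEMeasurable (fun ω => M.regressor Om i g ω j) μ := fun i j =>
    (isUnitStatistic_regressor (h.le.trans h.le_T) j).aemeasurable hiid.2 i
  have hell : ∀ i (a : M.comp μ t), AEMeasurable (fun ω => M.ell μ i t ω a) μ := fun i a => by
    simp only [ell_apply]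
    exact (hI a i).const_mul _
  have hΓ : ∀ a j, AEMeasurable (fun ω => M.GamHat μ Om g t n ω a j) μ := fun a j =>
    aemeasurable_sampleMean (f := fun i ω => M.ell μ i t ω a * M.regressor Om i g ω j)
      (fun i => (hell i a).mul (hZ i j)) n
  have hm : ∀ a, AEMeasurable (fun ω => M.momentHat μ g t n ω a) μ := fun a =>
    aemeasurable_sampleMean (f := fun i ω => M.ell μ i t ω a * (M.Y i t ω - M.Y i (g - 1) ω))
      (fun i => (hell i a).mul (hYt i)) n
  have hδ : ∀ j, AEMeasurable (fun ω => M.deltaHat μ Om What g t n ω j) μ := fun j =>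
    Finset.aemeasurable_fun_sum (f := fun a ω =>
      gmmMatrix (M.GamHat μ Om g t n ω) (What g t n ω) j a * M.momentHat μ g t n ω a) Finset.univ
      fun a _ => (aemeasurable_gmmMatrix_apply hΓ (hw n) j a).mul (hm a)
  have hA : ∀ j, AEMeasurable (fun ω => M.AHat Om g n ω j) μ := fun j =>
    aemeasurable_sampleMean (f := fun i ω => M.A Om i g ω j)
      (fun i => (hI g i).mul (hZ i j)) n
  have hX : AEMeasurable (fun ω => sampleMean n (fun i ω => M.X i g t ω) ω) μ :=
    aemeasurable_sampleMean (fun i => (hI g i).mul (hYt i)) n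
  have hp : AEMeasurable (fun ω => M.pHat g n ω) μ := aemeasurable_sampleMean (fun i => hI g i) n
  exact hp.inv.mul (hX.sub (Finset.aemeasurable_fun_sum
    (f := fun j ω => M.AHat Om g n ω j * M.deltaHat μ Om What g t n ω j) Finset.univ
    fun j _ => (hA j).mul (hδ j)))

variable [IsProbabilityMeasure μ]

theorem pairRegularity (hreg : M.Regular μ) (hanti : M.NoAnticipation μ) (hiid : M.IIDSampling μ)
    (hife : M.InteractiveFixedEffects μ) (herr : M.ErrorsMeanZero μ) (hunc : M.Unconfounded μ)
    (hrank : M.RankConditions μ) (hOm : M.ValidOmega μ Om) (hmom : M.FourthMoment μ)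
    (hW : M.WeightingConsistent μ What W) {k : ℕ × ℕ} (hk : k ∈ M.identified μ) :
    M.PairRegularity μ Om W k.1 k.2 := by
  obtain ⟨h1, h2, h3, h4⟩ := bounds_of_mem_identified hk
  have hQ : IsUnit ((Om k.1)ᵀ * M.dFpre k.1).det :=
    isUnit_det_of_rank_eq ((hOm k hk).2.trans (hrank k hk).1)
  exact ⟨h1, h2, h3, h4, hQ, isUnit_det_transpose_mul_mul (hW k hk).1
    (Gam_mulVec_injective hreg hanti hiid hife herr hunc hmom h2 h3 hQ (hrank k hk).2)⟩

variable {g t : ℕ}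

theorem memLp_attScore (hreg : M.Regular μ) (hiid : M.IIDSampling μ) (hmom : M.FourthMoment μ)
    (h : M.PairRegularity μ Om W g t) : MemLp (M.attScore μ Om 0 g t) 2 μ :=
  memLp_inGroup_mul hreg.measurable_group _
    ((memLp_resid hiid hmom h.two_le h.le h.le_T).sub (memLp_const _))

theorem memLp_compScore (hreg : M.Regular μ) (hiid : M.IIDSampling μ) (hmom : M.FourthMoment μ)
    (h : M.PairRegularity μ Om W g t) (a : M.comp μ t) :
    MemLp (fun ω => M.compScore μ Om 0 g t ω a) 2 μ := by
  simp only [compScore, ell_apply, mul_assoc]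
  exact (memLp_inGroup_mul hreg.measurable_group _
    (memLp_resid hiid hmom h.two_le h.le h.le_T)).const_mul _

theorem integral_attScore (hreg : M.Regular μ) (hanti : M.NoAnticipation μ)
    (hiid : M.IIDSampling μ) (hife : M.InteractiveFixedEffects μ) (herr : M.ErrorsMeanZero μ)
    (hunc : M.Unconfounded μ) (hmom : M.FourthMoment μ) (h : M.PairRegularity μ Om W g t) :
    ∫ ω, M.attScore μ Om 0 g t ω ∂μ = 0 := by
  have hG := hreg.measurable_group
  have hX : Integrable (M.X 0 g t) μ := integrable_inGroup_mul hG g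
    (((memLp_Y hiid hmom (Finset.mem_Icc.2 ⟨h.two_le.trans h.le |>.trans' one_le_two, h.le_T⟩)).sub
    (memLp_Y hiid hmom (Finset.mem_Icc.2 ⟨by have := h.two_le; omega,
      by have := h.le; have := h.le_T; omega⟩))).integrable one_le_two)
  have hA : ∀ j, Integrable (fun ω => M.A Om 0 g ω j) μ := fun j =>
    integrable_inGroup_mul hG g
      ((memLp_regressor hiid hmom (h.le.trans h.le_T) j).integrable one_le_two)
  have hI : Integrable (M.inGroup 0 g) μ := integrable_inGroup hG g
  have hδ : ∫ ω, M.deltaStar Om g t ⬝ᵥ M.A Om 0 g ω ∂μ =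
      M.deltaStar Om g t ⬝ᵥ M.meanA μ Om g := by
    simp only [dotProduct, meanA]
    rw [integral_finsetSum _ fun j _ => (hA j).const_mul _]
    simp only [integral_const_mul]
  have hδi : Integrable (fun ω => M.deltaStar Om g t ⬝ᵥ M.A Om 0 g ω) μ :=
    integrable_finsetSum _ fun j _ => (hA j).const_mul _
  have hp := p_mul_ATT hreg hanti hiid hife herr hunc hmom h.two_le h.le h.le_T h.p_pos h.det_factor
  simp only [attScore_eq]
  have hXδ : Integrable (fun ω => M.X 0 g t ω - M.deltaStar Om g t ⬝ᵥ M.A Om 0 g ω) μ := hX.sub hδi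
  rw [integral_sub hXδ (hI.const_mul _), integral_sub hX hδi, hδ, integral_const_mul,
    integral_inGroup hG]
  linarith

theorem integral_compScore (hreg : M.Regular μ) (hanti : M.NoAnticipation μ)
    (hife : M.InteractiveFixedEffects μ) (herr : M.ErrorsMeanZero μ)
    (hunc : M.Unconfounded μ) (h : M.PairRegularity μ Om W g t) (a : M.comp μ t) :
    ∫ ω, M.compScore μ Om 0 g t ω a ∂μ = 0 := by
  have hv := groupCentered_v (Om := Om) hreg hife herr hunc h.two_le h.le h.le_T
  simp only [compScore, ell_apply, mul_assoc]
  rw [integral_const_mul, integral_congr_ae (ae_inGroup_mul_resid hanti hife h.two_le h.le h.le_T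
    h.det_factor (lt_of_mem_comp a) 0), hv.2, mul_zero]

/-- The influence function is `p_g⁻¹ (attScore - E[A]' B compScore)`.  The constants in `ψ⁽¹⁾`, `ψ⁽³⁾`
and `ψ⁽⁴⁾` cancel by identification of `ATT(g,t)`, and the unobserved `v_i` in `ψ⁽²⁾` is replaced by
a function of the observed data, to which the sampling assumption applies. -/
theorem ae_psi_eq (hreg : M.Regular μ) (hanti : M.NoAnticipation μ) (hiid : M.IIDSampling μ)
    (hife : M.InteractiveFixedEffects μ) (herr : M.ErrorsMeanZero μ) (hunc : M.Unconfounded μ)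
    (hmom : M.FourthMoment μ) (h : M.PairRegularity μ Om W g t) (i : ℕ) :
    M.psi μ Om W i g t =ᵐ[μ] fun ω => (M.p μ g)⁻¹ *
      (M.attScore μ Om i g t ω - M.compWeight μ Om W g t ⬝ᵥ M.compScore μ Om i g t ω) := by
  have hp := p_mul_ATT hreg hanti hiid hife herr hunc hmom h.two_le h.le h.le_T h.p_pos h.det_factor
  have hv : ∀ᵐ ω ∂μ, ∀ a : M.comp μ t,
      M.ell μ i t ω a * M.v Om i g t ω = M.compScore μ Om i g t ω a := by
    refine ae_all_iff.2 fun a => ?_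
    filter_upwards [ae_inGroup_mul_resid hanti hife h.two_le h.le h.le_T
      h.det_factor (lt_of_mem_comp a) i] with ω hω
    rw [compScore, ell_apply, mul_assoc, mul_assoc, hω]
  have hp0 := h.p_pos.ne'
  filter_upwards [hv] with ω hω
  have e2 : M.psi2 μ Om W i g t ω =
      -((M.compWeight μ Om W g t ⬝ᵥ M.compScore μ Om i g t ω) / M.p μ g) := by
    rw [psi2, funext hω, compWeight, ← dotProduct_mulVec]
    rfl
  rw [psi, e2, psi1, psi3, psi4, attScore_eq, dotProduct_sub, eq_comm, inGroup]
  field_simp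
  linear_combination -hp

theorem isUnitStatistic_psi (hreg : M.Regular μ) (hanti : M.NoAnticipation μ)
    (hiid : M.IIDSampling μ) (hife : M.InteractiveFixedEffects μ) (herr : M.ErrorsMeanZero μ)
    (hunc : M.Unconfounded μ) (hmom : M.FourthMoment μ) {g t : ℕ}
    (h : M.PairRegularity μ Om W g t) :
    IsUnitStatistic μ M.obs fun i ω => M.psi μ Om W i g t ω :=
  ((IsUnitStatistic.const _).mul ((isUnitStatistic_attScore h).sub (IsUnitStatistic.dotProduct _
    fun a => isUnitStatistic_compScore h a))).congr
    fun i => ae_psi_eq hreg hanti hiid hife herr hunc hmom h i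

theorem memLp_psi (hreg : M.Regular μ) (hanti : M.NoAnticipation μ)
    (hiid : M.IIDSampling μ) (hife : M.InteractiveFixedEffects μ) (herr : M.ErrorsMeanZero μ)
    (hunc : M.Unconfounded μ) (hmom : M.FourthMoment μ) {g t : ℕ}
    (h : M.PairRegularity μ Om W g t) : MemLp (M.psi μ Om W 0 g t) 2 μ :=
  (memLp_congr_ae (ae_psi_eq hreg hanti hiid hife herr hunc hmom h 0)).2
    (((memLp_attScore hreg hiid hmom h).sub
      (memLp_dotProduct _ fun a => memLp_compScore hreg hiid hmom h a)).const_mul _)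

theorem integral_psi (hreg : M.Regular μ) (hanti : M.NoAnticipation μ)
    (hiid : M.IIDSampling μ) (hife : M.InteractiveFixedEffects μ) (herr : M.ErrorsMeanZero μ)
    (hunc : M.Unconfounded μ) (hmom : M.FourthMoment μ) {g t : ℕ}
    (h : M.PairRegularity μ Om W g t) : ∫ ω, M.psi μ Om W 0 g t ω ∂μ = 0 := by
  have hc : ∀ a, Integrable (fun ω => M.compScore μ Om 0 g t ω a) μ := fun a =>
    (memLp_compScore hreg hiid hmom h a).integrable one_le_two
  have h2 : ∫ ω, M.compWeight μ Om W g t ⬝ᵥ M.compScore μ Om 0 g t ω ∂μ = 0 := by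
    simp only [dotProduct]
    rw [integral_finsetSum _ fun a _ => (hc a).const_mul _]
    simp [integral_const_mul, integral_compScore hreg hanti hife herr hunc h]
  rw [integral_congr_ae (ae_psi_eq hreg hanti hiid hife herr hunc hmom h 0), integral_const_mul,
    integral_sub ((memLp_attScore hreg hiid hmom h).integrable one_le_two)
      ((memLp_dotProduct _ fun a => memLp_compScore hreg hiid hmom h a).integrable one_le_two),
    integral_attScore hreg hanti hiid hife herr hunc hmom h, h2, sub_zero, mul_zero]

/-! ### Asymptotic linearity for an identified pair -/

theorem tendsto_pHat (hreg : M.Regular μ) (hiid : M.IIDSampling μ) :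
    Tendsto (fun x : ℕ × Ω => M.pHat g x.1 x.2) (inProb μ) (𝓝 (M.p μ g)) := by
  have hs := isUnitStatistic_inGroup (M := M) (μ := μ) g
  rw [← integral_inGroup (μ := μ) hreg.measurable_group]
  exact tendsto_sampleMean_inProb (hs.iIndepFun hiid.1) (hs.identDistrib hiid.2)
    (integrable_inGroup hreg.measurable_group g)

theorem tendsto_AHat (hreg : M.Regular μ) (hiid : M.IIDSampling μ) (hmom : M.FourthMoment μ)
    (hgT : g ≤ T) :
    Tendsto (fun x : ℕ × Ω => M.AHat Om g x.1 x.2) (inProb μ) (𝓝 (M.meanA μ Om g)) := by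
  refine tendsto_pi_nhds.2 fun j => ?_
  have hs : IsUnitStatistic μ M.obs fun i ω => M.A Om i g ω j :=
    (isUnitStatistic_inGroup g).mul (isUnitStatistic_regressor hgT j)
  exact tendsto_sampleMean_inProb (hs.iIndepFun hiid.1) (hs.identDistrib hiid.2)
    (integrable_inGroup_mul hreg.measurable_group g
      ((memLp_regressor hiid hmom hgT j).integrable one_le_two))

theorem tendsto_GamHat (hreg : M.Regular μ) (hiid : M.IIDSampling μ) (hmom : M.FourthMoment μ)
    (hgT : g ≤ T) :
    Tendsto (fun x : ℕ × Ω => M.GamHat μ Om g t x.1 x.2) (inProb μ) (𝓝 (M.Gam μ Om g t)) := by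
  have key : ∀ a j, Tendsto (fun x : ℕ × Ω => M.GamHat μ Om g t x.1 x.2 a j) (inProb μ)
      (𝓝 (M.Gam μ Om g t a j)) := fun a j => by
    have hs : IsUnitStatistic μ M.obs fun i ω => M.ell μ i t ω a * M.regressor Om i g ω j := by
      simp only [ell_apply]
      exact ((IsUnitStatistic.const _).mul (isUnitStatistic_inGroup _)).mul
        (isUnitStatistic_regressor hgT j)
    simp only [GamHat, Gam, of_apply]
    exact tendsto_sampleMean_inProb (hs.iIndepFun hiid.1) (hs.identDistrib hiid.2)
      (integrable_ell_mul hreg.measurable_group a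
        ((memLp_regressor hiid hmom hgT j).integrable one_le_two))
  exact tendsto_pi_nhds.2 fun a => tendsto_pi_nhds.2 fun j => key a j

/-- The estimated weights of the comparison groups are consistent, by continuity of `gmmMatrix` where
`Γ' W Γ` is invertible. -/
theorem tendsto_compWeightHat (hreg : M.Regular μ) (hiid : M.IIDSampling μ)
    (hmom : M.FourthMoment μ) (h : M.PairRegularity μ Om W g t) (hw : WeightTendsto What W g t) :
    Tendsto (fun x : ℕ × Ω => M.compWeightHat μ Om What g t x.1 x.2) (inProb μ)
      (𝓝 (M.compWeight μ Om W g t)) := by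
  have hA := tendsto_AHat (Om := Om) hreg hiid hmom (h.le.trans h.le_T)
  have hΓ := tendsto_GamHat (Om := Om) (t := t) hreg hiid hmom (h.le.trans h.le_T)
  have hB := (continuousAt_gmmMatrix h.det_moment).tendsto.comp (hΓ.prodMk_nhds hw)
  have hc : Continuous fun y : (Fin (R + 1) → ℝ) × Matrix (Fin (R + 1)) (M.comp μ t) ℝ =>
      y.1 ᵥ* y.2 := continuous_fst.matrix_vecMul continuous_snd
  exact (hc.tendsto (M.meanA μ Om g, gmmMatrix (M.Gam μ Om g t) (W g t))).comp
    (hA.prodMk_nhds hB)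

theorem eventually_isUnit_det (hreg : M.Regular μ) (hiid : M.IIDSampling μ)
    (hmom : M.FourthMoment μ) (h : M.PairRegularity μ Om W g t) (hw : WeightTendsto What W g t) :
    ∀ᶠ x : ℕ × Ω in inProb μ, IsUnit ((M.GamHat μ Om g t x.1 x.2)ᵀ * What g t x.1 x.2 *
      M.GamHat μ Om g t x.1 x.2).det := by
  have hΓ := tendsto_GamHat (Om := Om) (t := t) hreg hiid hmom (h.le.trans h.le_T)
  have hq : Continuous fun y : Matrix (M.comp μ t) (Fin (R + 1)) ℝ ×
      Matrix (M.comp μ t) (M.comp μ t) ℝ => (y.1ᵀ * y.2 * y.1).det :=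
    ((continuous_fst.matrix_transpose.matrix_mul continuous_snd).matrix_mul
      continuous_fst).matrix_det
  have hd := (hq.tendsto (M.Gam μ Om g t, W g t)).comp (hΓ.prodMk_nhds hw)
  filter_upwards [hd.eventually_ne h.det_moment.ne_zero] with x hx
  exact isUnit_iff_ne_zero.2 hx

theorem eventually_ATTHat_sub_ATT (hreg : M.Regular μ) (hiid : M.IIDSampling μ)
    (hmom : M.FourthMoment μ) (h : M.PairRegularity μ Om W g t) (hw : WeightTendsto What W g t) :
    ∀ᶠ x : ℕ × Ω in inProb μ, M.ATTHat μ Om What g t x.1 x.2 - M.ATT μ g t =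
      (M.pHat g x.1 x.2)⁻¹ * (sampleMean x.1 (fun i ω => M.attScore μ Om i g t ω) x.2 -
        M.compWeightHat μ Om What g t x.1 x.2 ⬝ᵥ
          fun a => sampleMean x.1 (fun i ω => M.compScore μ Om i g t ω a) x.2) := by
  filter_upwards [eventually_isUnit_det hreg hiid hmom h hw,
    (tendsto_pHat hreg hiid).eventually_ne h.p_pos.ne'] with x h1 h2
  exact ATTHat_sub_ATT h1 h2

/-- Consistency of the estimator of `ATT(g,t)`. -/
theorem tendsto_ATTHat (hreg : M.Regular μ) (hanti : M.NoAnticipation μ) (hiid : M.IIDSampling μ)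
    (hife : M.InteractiveFixedEffects μ) (herr : M.ErrorsMeanZero μ) (hunc : M.Unconfounded μ)
    (hmom : M.FourthMoment μ) (h : M.PairRegularity μ Om W g t) (hw : WeightTendsto What W g t) :
    Tendsto (fun x : ℕ × Ω => M.ATTHat μ Om What g t x.1 x.2 - M.ATT μ g t) (inProb μ) (𝓝 0) := by
  have hs := isUnitStatistic_attScore h
  have h1 := tendsto_sampleMean_inProb (hs.iIndepFun hiid.1) (hs.identDistrib hiid.2)
    ((memLp_attScore hreg hiid hmom h).integrable one_le_two)
  rw [integral_attScore hreg hanti hiid hife herr hunc hmom h] at h1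
  have h2 : Tendsto (fun x : ℕ × Ω =>
      fun a => sampleMean x.1 (fun i ω => M.compScore μ Om i g t ω a) x.2) (inProb μ) (𝓝 0) := by
    refine tendsto_pi_nhds.2 fun a => ?_
    have hs := isUnitStatistic_compScore h a
    have h2 := tendsto_sampleMean_inProb (hs.iIndepFun hiid.1) (hs.identDistrib hiid.2)
      ((memLp_compScore hreg hiid hmom h a).integrable one_le_two)
    rwa [integral_compScore hreg hanti hife herr hunc h] at h2
  have hc : Continuous fun y : (M.comp μ t → ℝ) × (M.comp μ t → ℝ) => y.1 ⬝ᵥ y.2 :=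
    continuous_fst.dotProduct continuous_snd
  have h3 := (hc.tendsto (M.compWeight μ Om W g t, 0)).comp
    ((tendsto_compWeightHat hreg hiid hmom h hw).prodMk_nhds h2)
  have h4 := ((tendsto_pHat (g := g) hreg hiid).inv₀ h.p_pos.ne').mul (h1.sub h3)
  simp only [dotProduct_zero, sub_zero, mul_zero] at h4
  refine h4.congr' ?_
  filter_upwards [eventually_ATTHat_sub_ATT hreg hiid hmom h hw] with x hx
  exact hx.symm

/-- Asymptotic linearity for a single pair.  The remainder is a combination of normalised sums of
`attScore` and `compScore` whose coefficients, the differences of `p̂_g⁻¹` and `p̂_g⁻¹ 𝔼_n[A]' B̂` from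
their limits, vanish in probability. -/
theorem tendsto_ATTHat_remainder (hreg : M.Regular μ) (hanti : M.NoAnticipation μ)
    (hiid : M.IIDSampling μ) (hife : M.InteractiveFixedEffects μ) (herr : M.ErrorsMeanZero μ)
    (hunc : M.Unconfounded μ) (hmom : M.FourthMoment μ) (h : M.PairRegularity μ Om W g t)
    (hw : WeightTendsto What W g t) :
    Tendsto (fun x : ℕ × Ω => √(x.1 : ℝ) * (M.ATTHat μ Om What g t x.1 x.2 - M.ATT μ g t) -
      (√(x.1 : ℝ))⁻¹ * ∑ i ∈ Finset.range x.1, M.psi μ Om W i g t x.2) (inProb μ) (𝓝 0) := by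
  have hp := (tendsto_pHat (g := g) hreg hiid).inv₀ h.p_pos.ne'
  have hc := tendsto_pi_nhds.1 (tendsto_compWeightHat hreg hiid hmom h hw)
  have hs := isUnitStatistic_attScore h
  have h1 := tendsto_mul_sqrt_mul_sampleMean (hs.iIndepFun hiid.1) (hs.identDistrib hiid.2)
    (memLp_attScore hreg hiid hmom h)
    (integral_attScore hreg hanti hiid hife herr hunc hmom h)
    (f := fun x => (M.pHat g x.1 x.2)⁻¹ - (M.p μ g)⁻¹) (by simpa using hp.sub_const (M.p μ g)⁻¹)
  have h2 : ∀ a, Tendsto (fun x : ℕ × Ω =>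
      ((M.pHat g x.1 x.2)⁻¹ * M.compWeightHat μ Om What g t x.1 x.2 a -
        (M.p μ g)⁻¹ * M.compWeight μ Om W g t a) *
      (√(x.1 : ℝ) * sampleMean x.1 (fun i ω => M.compScore μ Om i g t ω a) x.2))
      (inProb μ) (𝓝 0) := fun a => by
    have hs := isUnitStatistic_compScore h a
    exact tendsto_mul_sqrt_mul_sampleMean (hs.iIndepFun hiid.1) (hs.identDistrib hiid.2)
      (memLp_compScore hreg hiid hmom h a) (integral_compScore hreg hanti hife herr hunc h a)
      (f := fun x => (M.pHat g x.1 x.2)⁻¹ * M.compWeightHat μ Om What g t x.1 x.2 a -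
        (M.p μ g)⁻¹ * M.compWeight μ Om W g t a)
      (by simpa using (hp.mul (hc a)).sub_const ((M.p μ g)⁻¹ * M.compWeight μ Om W g t a))
  have h3 := h1.sub (tendsto_finsetSum Finset.univ fun a _ => h2 a)
  simp only [Finset.sum_const_zero, sub_zero] at h3
  refine h3.congr' ?_
  have hψ : ∀ᶠ x : ℕ × Ω in inProb μ, ∀ i, M.psi μ Om W i g t x.2 = (M.p μ g)⁻¹ *
      (M.attScore μ Om i g t x.2 - M.compWeight μ Om W g t ⬝ᵥ M.compScore μ Om i g t x.2) :=
    eventually_inProb_of_ae fun _ =>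
      ae_all_iff.2 fun i => ae_psi_eq hreg hanti hiid hife herr hunc hmom h i
  filter_upwards [eventually_ATTHat_sub_ATT hreg hiid hmom h hw, hψ] with x hx hψx
  have e1 : (√(x.1 : ℝ))⁻¹ * ∑ i ∈ Finset.range x.1, M.psi μ Om W i g t x.2 =
      √(x.1 : ℝ) * ((M.p μ g)⁻¹ * (sampleMean x.1 (fun i ω => M.attScore μ Om i g t ω) x.2 -
        M.compWeight μ Om W g t ⬝ᵥ
          fun a => sampleMean x.1 (fun i ω => M.compScore μ Om i g t ω a) x.2)) := by
    rw [← sampleMean_dotProduct, ← sampleMean_sub, ← sampleMean_const_mul, sqrt_mul_sampleMean]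
    simp only [hψx]
  have e2 : ∀ c d : M.comp μ t → ℝ, ∀ q r : ℝ, ∑ a, (q * c a - r * d a) *
      (√(x.1 : ℝ) * sampleMean x.1 (fun i ω => M.compScore μ Om i g t ω a) x.2) =
      √(x.1 : ℝ) * (q * (c ⬝ᵥ fun a => sampleMean x.1 (fun i ω => M.compScore μ Om i g t ω a) x.2) -
        r * (d ⬝ᵥ fun a => sampleMean x.1 (fun i ω => M.compScore μ Om i g t ω a) x.2)) := by
    intro c d q r
    simp only [dotProduct, Finset.mul_sum, ← Finset.sum_sub_distrib]
    exact Finset.sum_congr rfl fun a _ => by ring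
  rw [hx, e1, e2]
  ring

end PanelModel

end

/-! ### The stacked and the aggregated estimator -/

theorem mainTheorem4 {Ω : Type*} [MeasurableSpace Ω] (μ : Measure Ω) [IsProbabilityMeasure μ]
    {T R : ℕ} (M : PanelModel Ω T R)
    (Om : (g : ℕ) → Matrix (Finset.Ico 2 g) (Fin R) ℝ)
    (What : (g t n : ℕ) → Ω → Matrix (M.comp μ t) (M.comp μ t) ℝ)
    (W : (g t : ℕ) → Matrix (M.comp μ t) (M.comp μ t) ℝ)
    (hreg : M.Regular μ)
    (hfirst : M.NoTreatmentInFirstPeriod μ)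
    (hstag : M.StaggeredAdoption μ)
    (hanti : M.NoAnticipation μ)
    (hiid : M.IIDSampling μ)
    (hife : M.InteractiveFixedEffects μ)
    (herr : M.ErrorsMeanZero μ)
    (hunc : M.Unconfounded μ)
    (hrank : M.RankConditions μ)
    (hOm : M.ValidOmega μ Om)
    (hmom : M.FourthMoment μ)
    (hW : M.WeightingConsistent μ What W) :
    -- the influence vector is centred and square integrable
    (MemLp (M.Psi μ Om W 0) 2 μ ∧ ∫ ω, M.Psi μ Om W 0 ω ∂μ = 0) ∧
    -- asymptotic linear representation of the stacked estimator
    TendstoInMeasure μ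
      (fun (n : ℕ) ω =>
        √(n : ℝ) • (M.ATTHatVec μ Om What n ω - M.ATTvec μ) -
          (√(n : ℝ))⁻¹ • ∑ i ∈ Finset.range n, M.Psi μ Om W i ω)
      atTop (fun _ => 0) ∧
    -- joint asymptotic normality
    TendstoInDistribution
      (fun (n : ℕ) ω => √(n : ℝ) • (M.ATTHatVec μ Om What n ω - M.ATTvec μ))
      atTop id (fun _ => μ) (multivariateGaussian 0 (M.PsiCov μ Om W)) ∧
    -- aggregation with asymptotically linear estimated weights
    ∀ (w : EuclideanSpace ℝ (M.identified μ))
      (wHat : ℕ → Ω → EuclideanSpace ℝ (M.identified μ))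
      (Winf : ℕ → Ω → EuclideanSpace ℝ (M.identified μ)),
      (∀ n, AEMeasurable (wHat n) μ) →
      iIndepFun (fun i ω => (M.obs i ω, Winf i ω)) μ →
      (∀ i, IdentDistrib (fun ω => (M.obs i ω, Winf i ω)) (fun ω => (M.obs 0 ω, Winf 0 ω)) μ μ) →
      MemLp (Winf 0) 2 μ →
      ∫ ω, Winf 0 ω ∂μ = 0 →
      TendstoInMeasure μ
        (fun (n : ℕ) ω =>
          √(n : ℝ) • (wHat n ω - w) - (√(n : ℝ))⁻¹ • ∑ i ∈ Finset.range n, Winf i ω)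
        atTop (fun _ => 0) →
      TendstoInMeasure μ
        (fun (n : ℕ) ω =>
          √(n : ℝ) * (∑ k, wHat n ω k * M.ATTHatVec μ Om What n ω k - ∑ k, w k * M.ATTvec μ k) -
            (√(n : ℝ))⁻¹ * ∑ i ∈ Finset.range n, M.aggInfluence μ Om W w Winf i ω)
        atTop (fun _ => 0) ∧
      TendstoInDistribution
        (fun (n : ℕ) ω =>
          √(n : ℝ) * (∑ k, wHat n ω k * M.ATTHatVec μ Om What n ω k - ∑ k, w k * M.ATTvec μ k))
        atTop id (fun _ => μ)
        (gaussianReal 0 (∫ ω, (M.aggInfluence μ Om W w Winf 0 ω) ^ 2 ∂μ).toNNReal) := by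
  have hpair : ∀ k : M.identified μ, M.PairRegularity μ Om W k.1.1 k.1.2 := fun k =>
    PanelModel.pairRegularity hreg hanti hiid hife herr hunc hrank hOm hmom hW k.2
  have hweight : ∀ k : M.identified μ, PanelModel.WeightTendsto What W k.1.1 k.1.2 := fun k =>
    PanelModel.weightTendsto hW k.2
  have hψstat : ∀ k : M.identified μ, IsUnitStatistic μ M.obs fun i ω => M.Psi μ Om W i ω k :=
    fun k => PanelModel.isUnitStatistic_psi hreg hanti hiid hife herr hunc hmom (hpair k)
  have hΨstat : IsUnitStatistic μ M.obs fun i ω => M.Psi μ Om W i ω := IsUnitStatistic.euclideanSpace hψstat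
  have hψL2 : ∀ k : M.identified μ, MemLp (fun ω => M.Psi μ Om W 0 ω k) 2 μ :=
    fun k => PanelModel.memLp_psi hreg hanti hiid hife herr hunc hmom (hpair k)
  have hΨL2 : MemLp (M.Psi μ Om W 0) 2 μ := MemLp.of_eval_piLp hψL2
  have hψ0 : ∀ k : M.identified μ, ∫ ω, M.Psi μ Om W 0 ω k ∂μ = 0 :=
    fun k => PanelModel.integral_psi hreg hanti hiid hife herr hunc hmom (hpair k)
  have hΨ0 : ∫ ω, M.Psi μ Om W 0 ω ∂μ = 0 := by
    ext k
    rw [eval_integral_piLp fun k => (hψL2 k).integrable one_le_two, hψ0 k]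
    rfl
  have hrem : ∀ k : M.identified μ, Tendsto (fun x : ℕ × Ω => √(x.1 : ℝ) *
      (M.ATTHatVec μ Om What x.1 x.2 k - M.ATTvec μ k) -
      (√(x.1 : ℝ))⁻¹ * ∑ i ∈ Finset.range x.1, M.Psi μ Om W i x.2 k) (inProb μ) (𝓝 0) := fun k =>
    PanelModel.tendsto_ATTHat_remainder hreg hanti hiid hife herr hunc hmom (hpair k) (hweight k)
  have hcons : ∀ k : M.identified μ, Tendsto (fun x : ℕ × Ω =>
      M.ATTHatVec μ Om What x.1 x.2 k - M.ATTvec μ k) (inProb μ) (𝓝 0) := fun k =>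
    PanelModel.tendsto_ATTHat hreg hanti hiid hife herr hunc hmom (hpair k) (hweight k)
  -- `Ŵ` is only almost everywhere measurable, hence so is the estimator
  have hmeas : ∀ (n : ℕ) (k : M.identified μ),
      AEMeasurable (fun ω => M.ATTHatVec μ Om What n ω k) μ := fun n k =>
    PanelModel.aemeasurable_ATTHat hiid (hpair k) (fun n a b => ((hW k k.2).2 a b).1 n) n
  have hmeasVec : ∀ n : ℕ, AEMeasurable (fun ω => M.ATTHatVec μ Om What n ω) μ := fun n =>
    Measurable.comp_aemeasurable (g := fun x : M.identified μ → ℝ => WithLp.toLp 2 x)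
      (f := fun ω k => M.ATTHatVec μ Om What n ω k) (by fun_prop) (aemeasurable_pi_lambda _ (hmeas n))
  have hlin : TendstoInMeasure μ
      (fun (n : ℕ) ω =>
        √(n : ℝ) • (M.ATTHatVec μ Om What n ω - M.ATTvec μ) -
          (√(n : ℝ))⁻¹ • ∑ i ∈ Finset.range n, M.Psi μ Om W i ω)
      atTop (fun _ => 0) := by
    refine tendstoInMeasure_euclideanSpace.2 fun k => ?_
    simpa using hrem k
  refine ⟨⟨hΨL2, hΨ0⟩, hlin, ?_, ?_⟩
  · exact tendstoInDistribution_of_tendstoInMeasure_sub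
      (fun (n : ℕ) ω => √(n : ℝ) • (M.ATTHatVec μ Om What n ω - M.ATTvec μ)) id
      (tendstoInDistribution_inv_sqrt_smul_sum (hΨstat.iIndepFun hiid.1)
        (hΨstat.identDistrib hiid.2) hΨL2 hΨ0) hlin
      (fun n => ((hmeasVec n).sub_const _).fun_const_smul _)
  intro w wHat Winf hwm hindep hident hWL2 hW0 hwlin
  -- the influence functions of both kinds are statistics of the pairs `(obs i, Winf i)`
  have hwstat : ∀ k, IsUnitStatistic μ (fun i ω => (M.obs i ω, Winf i ω)) fun i ω => Winf i ω k :=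
    fun k => .of_comp (φ := fun x : ((Finset.Icc 1 T → ℝ) × ℕ∞) ×
      EuclideanSpace ℝ (M.identified μ) => x.2 k) (by fun_prop)
  have hwL2 : ∀ k, MemLp (fun ω => Winf 0 ω k) 2 μ := fun k => hWL2.eval_piLp k
  have hw0 : ∀ k, ∫ ω, Winf 0 ω k ∂μ = 0 := fun k => by
    rw [← eval_integral_piLp fun k => (hwL2 k).integrable one_le_two, hW0]
    rfl
  have hwrem := tendstoInMeasure_euclideanSpace.1 hwlin
  have hagg : IsUnitStatistic μ (fun i ω => (M.obs i ω, Winf i ω))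
      fun i ω => M.aggInfluence μ Om W w Winf i ω :=
    (IsUnitStatistic.sum fun k _ => (IsUnitStatistic.const (w k)).mul
      ((hψstat k).of_data measurable_fst fun _ => rfl)).add
    (IsUnitStatistic.sum fun k _ => (IsUnitStatistic.const (M.ATTvec μ k)).mul (hwstat k))
  have haggL2 : MemLp (M.aggInfluence μ Om W w Winf 0) 2 μ :=
    (memLp_finsetSum _ fun k _ => (hψL2 k).const_mul (w k)).add
      (memLp_finsetSum _ fun k _ => (hwL2 k).const_mul (M.ATTvec μ k))
  have hagg0 : ∫ ω, M.aggInfluence μ Om W w Winf 0 ω ∂μ = 0 := by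
    have i1 : ∀ k, Integrable (fun ω => w k * M.Psi μ Om W 0 ω k) μ := fun k =>
      ((hψL2 k).integrable one_le_two).const_mul _
    have i2 : ∀ k, Integrable (fun ω => M.ATTvec μ k * Winf 0 ω k) μ := fun k =>
      ((hwL2 k).integrable one_le_two).const_mul _
    simp only [PanelModel.aggInfluence]
    rw [integral_add (integrable_finsetSum _ fun k _ => i1 k)
      (integrable_finsetSum _ fun k _ => i2 k), integral_finsetSum _ fun k _ => i1 k,
      integral_finsetSum _ fun k _ => i2 k]
    simp [integral_const_mul, hψ0, hw0]
  have hlin' : TendstoInMeasure μ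
      (fun (n : ℕ) ω =>
        √(n : ℝ) * (∑ k, wHat n ω k * M.ATTHatVec μ Om What n ω k - ∑ k, w k * M.ATTvec μ k) -
          (√(n : ℝ))⁻¹ * ∑ i ∈ Finset.range n, M.aggInfluence μ Om W w Winf i ω)
      atTop (fun _ => 0) := by
    -- `ŵ_k ÂTT_k - w_k ATT_k = (ŵ_k - w_k) ÂTT_k + w_k (ÂTT_k - ATT_k)`, where in the first product
    -- `ÂTT_k` is consistent and `√n (ŵ_k - w_k)` is a normalised sum up to a negligible term
    have h1 : ∀ k, Tendsto (fun x : ℕ × Ω =>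
        (√(x.1 : ℝ) * (wHat x.1 x.2 k - w k) -
          (√(x.1 : ℝ))⁻¹ * ∑ i ∈ Finset.range x.1, Winf i x.2 k) *
            (M.ATTHatVec μ Om What x.1 x.2 k - M.ATTvec μ k + M.ATTvec μ k) +
        (M.ATTHatVec μ Om What x.1 x.2 k - M.ATTvec μ k) *
          ((√(x.1 : ℝ))⁻¹ * ∑ i ∈ Finset.range x.1, Winf i x.2 k) +
        w k * (√(x.1 : ℝ) * (M.ATTHatVec μ Om What x.1 x.2 k - M.ATTvec μ k) -
          (√(x.1 : ℝ))⁻¹ * ∑ i ∈ Finset.range x.1, M.Psi μ Om W i x.2 k)) (inProb μ) (𝓝 0) := by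
      intro k
      have r1 := hwrem k
      simp only [PiLp.sub_apply, PiLp.smul_apply, smul_eq_mul, WithLp.ofLp_sum, Finset.sum_apply,
        PiLp.zero_apply] at r1
      have r2 := tendsto_mul_inv_sqrt_mul_sum ((hwstat k).iIndepFun hindep)
        ((hwstat k).identDistrib hident) (hwL2 k) (hw0 k) (hcons k)
      simpa using ((r1.mul ((hcons k).add_const (M.ATTvec μ k))).add r2).add
        ((hrem k).const_mul (w k))
    have h2 := tendsto_finsetSum Finset.univ fun k _ => h1 k
    simp only [Finset.sum_const_zero] at h2
    refine tendstoInMeasure_const_iff.2 (h2.congr fun x => ?_)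
    have e : (√(x.1 : ℝ))⁻¹ * ∑ i ∈ Finset.range x.1, M.aggInfluence μ Om W w Winf i x.2 =
        ∑ k, (w k * ((√(x.1 : ℝ))⁻¹ * ∑ i ∈ Finset.range x.1, M.Psi μ Om W i x.2 k) +
          M.ATTvec μ k * ((√(x.1 : ℝ))⁻¹ * ∑ i ∈ Finset.range x.1, Winf i x.2 k)) := by
      simp only [PanelModel.aggInfluence, ← Finset.sum_add_distrib, Finset.mul_sum]
      rw [Finset.sum_comm]
      exact Finset.sum_congr rfl fun k _ => Finset.sum_congr rfl fun i _ => by ring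
    rw [e, ← Finset.sum_sub_distrib, Finset.mul_sum, ← Finset.sum_sub_distrib]
    exact Finset.sum_congr rfl fun k _ => by ring
  refine ⟨hlin', tendstoInDistribution_of_tendstoInMeasure_sub _ id
    (tendstoInDistribution_inv_sqrt_mul_sum_centered (hagg.iIndepFun hindep)
      (hagg.identDistrib hident) haggL2 hagg0) hlin' fun n => ?_⟩
  have hwk : ∀ k, AEMeasurable (fun ω => wHat n ω k) μ := fun k =>
    Measurable.comp_aemeasurable (g := fun x : EuclideanSpace ℝ (M.identified μ) => x k)
      (by fun_prop) (hwm n)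
  exact ((Finset.aemeasurable_fun_sum _ fun k _ => (hwk k).mul (hmeas n k)).sub_const _).const_mul _
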